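/- Let $T=[x_0,x_1,x_2,x_3]\subset\mathbb R^3$ be a nondegenerate tetrahedron, let $z$ be any interior point of $T$, and let $T^{A}=\{T_0,T_1,T_2,T_3\}$ be the Alfeld split of $T$ at $z$, where $T_i$ is the tetrahedron obtained from $T$ by replacing the vertex $x_i$ by $z$. Let $\mathbb S$ be the space of symmetric real $3\times3$ matrices, and let $H(\mathrm{div},T,\mathbb S)$ be the space of (classes of) fields $\omega\in L^2(T,\mathbb S)$ whose row-wise distributional divergence $\mathrm{div}\,\omega$ belongs to $L^2(T,\mathbb R^3)$. Put $$\Sigma_h(T)=\{\omega\in H(\mathrm{div},T,\mathbb S):\ \omega|_K\in P_1(K,\mathbb S)\ \text{ for all } K\in T^{A}\},$$ where $P_1(K,\mathbb S)$ is the space of $\mathbb S$-valued polynomials of degree at most one on $K$. Let $n$ be the outward unit normal on $\partial T$; on the facet $F_i$ of $T$ opposite $x_i$, the normal trace $\omega n$ of $\omega\in\Sigma_h(T)$ is that of the polynomial $\omega|_{T_i}$. Then $\dim\Sigma_h(T)=42$. Moreover, an element $\omega\in\Sigma_h(T)$ is uniquely determined by the degrees of freedom $$\int_F \omega n\cdot\kappa,\quad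 \kappa\in[P_1(F)]^3,\ F \text{ a facet of } T\quad(36\text{ dofs}),\qquad \int_T\omega\quad(6\text{ dofs}).$$ That is: the spaces $\prod_{F}[P_1(F)]^3$ (product over the four facets) and $\mathbb S$ have dimensions $36$ and $6$; two elements of $\Sigma_h(T)$ with the same degrees of freedom are equal; and for any linear functionals $\ell_F:[P_1(F)]^3\to\mathbb R$ (one for each facet $F$) and any $A\in\mathbb S$ there is exactly one $\omega\in\Sigma_h(T)$ with $\int_F\omega n\cdot\kappa=\ell_F(\kappa)$ for all facets $F$ and all $\kappa\in[P_1(F)]^3$, and with $\int_T\omega=A$. In addition, if $\omega\in\Sigma_h(T)$ satisfies $\mathrm{div}\,\omega=0$ in $T$ and $\omega n=0$ on $\partial T$, then $\omega=0$. -/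

import Mathlib

open MeasureTheory
open scoped Matrix

noncomputable section

/-- Three-dimensional Euclidean space. -/
abbrev E3 : Type := EuclideanSpace ℝ (Fin 3)

/-- The space `𝕊` of symmetric real `3 × 3` matrices. -/
def SymMat : Submodule ℝ (Matrix (Fin 3) (Fin 3) ℝ) where
  carrier := {A | A.IsSymm}
  add_mem' := fun ha hb => ha.add hb
  zero_mem' := Matrix.isSymm_zero
  smul_mem' := fun c _ ha => ha.smul c

/-- `P₁(D, V)`: the `V`-valued polynomials of degree at most one, restricted to `D`. -/
def P1 (D : Set E3) (V : Type) [AddCommGroup V] [Module ℝ V] : Submodule ℝ (D → V) where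
  carrier := {f | ∃ p : E3 →ᵃ[ℝ] V, ∀ x : D, f x = p x}
  add_mem' := by
    rintro f g ⟨p, hp⟩ ⟨q, hq⟩
    exact ⟨p + q, fun x => by simp [hp, hq]⟩
  zero_mem' := ⟨0, fun x => by simp⟩
  smul_mem' := by
    rintro c f ⟨p, hp⟩
    exact ⟨c • p, fun x => by simp [hp]⟩

/-- `g` is the row-wise divergence of `ω` on the interior of `D`, in the sense of distributions. -/
def IsWeakDiv (D : Set E3) (ω : E3 → SymMat) (g : E3 → Fin 3 → ℝ) : Prop :=
  ∀ φ : E3 → ℝ, ContDiff ℝ ((⊤ : ℕ∞) : WithTop ℕ∞) φ → HasCompactSupport φ → tsupport φ ⊆ interior D →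
    ∀ r : Fin 3,
      ∫ x in D, ∑ c : Fin 3, (ω x).1 r c * fderiv ℝ φ x (EuclideanSpace.single c 1) =
        - ∫ x in D, g x r * φ x

/-- Square integrability on `D` of every entry of a matrix field. -/
def IsL2Mat (D : Set E3) (ω : E3 → SymMat) : Prop :=
  ∀ r c : Fin 3, MemLp (fun x => (ω x).1 r c) 2 (volume.restrict D)

/-- Square integrability on `D` of every component of a vector field. -/
def IsL2Vec (D : Set E3) (g : E3 → Fin 3 → ℝ) : Prop :=
  ∀ r : Fin 3, MemLp (fun x => g x r) 2 (volume.restrict D)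

theorem integrable_mul_test {D : Set E3} {f ψ : E3 → ℝ} (hf : MemLp f 2 (volume.restrict D))
    (hψ : Continuous ψ) (hc : HasCompactSupport ψ) :
    Integrable (fun x => f x * ψ x) (volume.restrict D) :=
  hf.integrable_mul (q := 2) ((hψ.memLp_of_hasCompactSupport hc).restrict D)

theorem integrable_row_test {D : Set E3} {ω : E3 → SymMat} (hω : IsL2Mat D ω) {φ : E3 → ℝ}
    (hφ : ContDiff ℝ ((⊤ : ℕ∞) : WithTop ℕ∞) φ) (hc : HasCompactSupport φ) (r : Fin 3) :
    Integrable (fun x => ∑ c : Fin 3, (ω x).1 r c * fderiv ℝ φ x (EuclideanSpace.single c 1))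
      (volume.restrict D) := by
  refine integrable_finsetSum _ fun c _ => integrable_mul_test (hω r c) ?_ ?_
  · exact (hφ.continuous_fderiv (by simp)).clm_apply continuous_const
  · exact hc.fderiv_apply ℝ _

/-- `H(div, D, 𝕊)`, as a space of almost-everywhere classes on `D`. -/
def Hdiv (D : Set E3) : Submodule ℝ (E3 →ₘ[volume.restrict D] SymMat) where
  carrier := {ω | IsL2Mat D ω ∧ ∃ g : E3 → Fin 3 → ℝ, IsL2Vec D g ∧ IsWeakDiv D ω g}
  add_mem' := by
    rintro ω τ ⟨hω, g, hg, hgω⟩ ⟨hτ, h, hh, hhτ⟩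
    have key := AEEqFun.coeFn_add ω τ
    refine ⟨fun r c => ((hω r c).add (hτ r c)).ae_eq ?_, g + h,
      fun r => (hg r).add (hh r), ?_⟩
    · filter_upwards [key] with x hx
      rw [hx]; rfl
    · intro φ h1 h2 h3 r
      have e1 : ∫ x in D, ∑ c : Fin 3, ((ω + τ) x).1 r c *
            fderiv ℝ φ x (EuclideanSpace.single c 1) =
          ∫ x in D, (∑ c : Fin 3, (ω x).1 r c * fderiv ℝ φ x (EuclideanSpace.single c 1) +
            ∑ c : Fin 3, (τ x).1 r c * fderiv ℝ φ x (EuclideanSpace.single c 1)) := by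
        refine integral_congr_ae ?_
        filter_upwards [key] with x hx
        rw [hx, ← Finset.sum_add_distrib]
        refine Finset.sum_congr rfl fun c _ => ?_
        rw [← add_mul]; rfl
      have e2 : ∫ x in D, (g + h) x r * φ x = ∫ x in D, (g x r * φ x + h x r * φ x) := by
        refine integral_congr_ae (Filter.Eventually.of_forall fun x => ?_)
        simp only [Pi.add_apply, add_mul]
      rw [e1, e2, integral_add (integrable_row_test hω h1 h2 r) (integrable_row_test hτ h1 h2 r),
        integral_add (integrable_mul_test (hg r) h1.continuous h2)
          (integrable_mul_test (hh r) h1.continuous h2), hgω φ h1 h2 h3 r, hhτ φ h1 h2 h3 r,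
        neg_add]
  zero_mem' := by
    have key := AEEqFun.coeFn_zero (α := E3) (β := SymMat) (μ := volume.restrict D)
    refine ⟨fun r c => (MemLp.zero' (ε := ℝ)).ae_eq ?_, 0, fun r => MemLp.zero', ?_⟩
    · filter_upwards [key] with x hx
      rw [hx]; rfl
    · intro φ h1 h2 h3 r
      have e1 : ∫ x in D, ∑ c : Fin 3, ((0 : E3 →ₘ[volume.restrict D] SymMat) x).1 r c *
            fderiv ℝ φ x (EuclideanSpace.single c 1) = ∫ _x in D, (0 : ℝ) := by
        refine integral_congr_ae ?_
        filter_upwards [key] with x hx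
        rw [hx]; simp
      rw [e1]; simp
  smul_mem' := by
    rintro a ω ⟨hω, g, hg, hgω⟩
    have key := AEEqFun.coeFn_smul a ω
    refine ⟨fun r c => ((hω r c).const_smul a).ae_eq ?_, a • g,
      fun r => (hg r).const_smul a, ?_⟩
    · filter_upwards [key] with x hx
      rw [hx]; rfl
    · intro φ h1 h2 h3 r
      have e1 : ∫ x in D, ∑ c : Fin 3, ((a • ω) x).1 r c *
            fderiv ℝ φ x (EuclideanSpace.single c 1) =
          ∫ x in D, a * ∑ c : Fin 3, (ω x).1 r c *
            fderiv ℝ φ x (EuclideanSpace.single c 1) := by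
        refine integral_congr_ae ?_
        filter_upwards [key] with x hx
        rw [hx, Finset.mul_sum]
        refine Finset.sum_congr rfl fun c _ => ?_
        rw [← mul_assoc]; rfl
      have e2 : ∫ x in D, (a • g) x r * φ x = ∫ x in D, a * (g x r * φ x) := by
        refine integral_congr_ae (Filter.Eventually.of_forall fun x => ?_)
        simp only [Pi.smul_apply, smul_eq_mul, mul_assoc]
      rw [e1, e2, integral_const_mul, integral_const_mul, hgω φ h1 h2 h3 r, mul_neg]

/-- The closed tetrahedron spanned by `T`. -/
abbrev tet (T : Affine.Simplex ℝ E3 3) : Set E3 := T.closedInterior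

/-- The facet of `T` opposite the vertex `i`. -/
abbrev facet (T : Affine.Simplex ℝ E3 3) (i : Fin 4) : Set E3 := (T.faceOpposite i).closedInterior

/-- The tetrahedron of the Alfeld split of `T` at `z` that contains the facet opposite the
vertex `i`: the vertex `i` is replaced by `z`. -/
def alfeldTet (T : Affine.Simplex ℝ E3 3) (z : E3) (i : Fin 4) : Set E3 :=
  convexHull ℝ (Set.range (Function.update T.points i z))

/-- The unit outward normal of `T` on the facet opposite the vertex `i`: the normalised vector
from this vertex to the foot of its altitude. -/
def outwardNormal (T : Affine.Simplex ℝ E3 3) (i : Fin 4) : E3 :=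
  ‖T.altitudeFoot i - T.points i‖⁻¹ • (T.altitudeFoot i - T.points i)

/-- The affine field `p` represents `ω` on the `i`-th tetrahedron of the Alfeld split. -/
def IsPiece (T : Affine.Simplex ℝ E3 3) (z : E3) (ω : E3 → SymMat) (i : Fin 4)
    (p : E3 →ᵃ[ℝ] SymMat) : Prop :=
  ∀ᵐ x ∂(volume.restrict (alfeldTet T z i)), ω x = p x

theorem alfeldTet_subset {T : Affine.Simplex ℝ E3 3} {z : E3} (hz : z ∈ tet T) (i : Fin 4) :
    alfeldTet T z i ⊆ tet T := by
  have hT : tet T = convexHull ℝ (Set.range T.points) :=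
    T.convexHull_eq_closedInterior.symm
  refine convexHull_min ?_ (hT ▸ convex_convexHull ℝ _)
  rintro _ ⟨j, rfl⟩
  by_cases h : j = i
  · subst h; simpa using hz
  · rw [Function.update_of_ne h, hT]
    exact subset_convexHull ℝ _ ⟨j, rfl⟩

/-- The space `Σ_h(T)`: the fields in `H(div, T, 𝕊)` that are affine on each tetrahedron of the
Alfeld split of `T` at the point `z`. -/
def SigmaH (T : Affine.Simplex ℝ E3 3) (z : E3) (hz : z ∈ T.interior) :
    Submodule ℝ (E3 →ₘ[volume.restrict (tet T)] SymMat) where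
  carrier := {ω | ω ∈ Hdiv (tet T) ∧ ∀ i : Fin 4, ∃ p : E3 →ᵃ[ℝ] SymMat, IsPiece T z ω i p}
  add_mem' := by
    rintro ω τ ⟨hω, hω'⟩ ⟨hτ, hτ'⟩
    refine ⟨add_mem hω hτ, fun i => ?_⟩
    obtain ⟨p, hp⟩ := hω' i
    obtain ⟨q, hq⟩ := hτ' i
    have key := ae_restrict_of_ae_restrict_of_subset
      (alfeldTet_subset (T.interior_subset_closedInterior hz) i) (AEEqFun.coeFn_add ω τ)
    refine ⟨p + q, ?_⟩
    filter_upwards [hp, hq, key] with x h1 h2 h3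
    rw [h3, Pi.add_apply, h1, h2]; rfl
  zero_mem' := by
    refine ⟨zero_mem _, fun i => ⟨0, ?_⟩⟩
    have key := ae_restrict_of_ae_restrict_of_subset
      (alfeldTet_subset (T.interior_subset_closedInterior hz) i)
      (AEEqFun.coeFn_zero (α := E3) (β := SymMat) (μ := volume.restrict (tet T)))
    filter_upwards [key] with x h3
    rw [h3]; rfl
  smul_mem' := by
    rintro a ω ⟨hω, hω'⟩
    refine ⟨Submodule.smul_mem _ a hω, fun i => ?_⟩
    obtain ⟨p, hp⟩ := hω' i
    have key := ae_restrict_of_ae_restrict_of_subset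
      (alfeldTet_subset (T.interior_subset_closedInterior hz) i) (AEEqFun.coeFn_smul a ω)
    refine ⟨a • p, ?_⟩
    filter_upwards [hp, key] with x h1 h3
    rw [h3, Pi.smul_apply, h1]; rfl

open Classical in
/-- The affine field that represents `ω` on the `i`-th tetrahedron of the Alfeld split (and zero if
there is none); it gives the trace of `ω` on the facet opposite the vertex `i`. -/
def piece (T : Affine.Simplex ℝ E3 3) (z : E3) (ω : E3 → SymMat) (i : Fin 4) :
    E3 →ᵃ[ℝ] SymMat :=
  if h : ∃ p : E3 →ᵃ[ℝ] SymMat, IsPiece T z ω i p then h.choose else 0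

/-- The normal trace `ω n` on the facet opposite the vertex `i`. -/
def normalTrace (T : Affine.Simplex ℝ E3 3) (z : E3) (ω : E3 → SymMat) (i : Fin 4)
    (x : facet T i) : Fin 3 → ℝ :=
  (piece T z ω i x).1 *ᵥ (outwardNormal T i).ofLp

/-- The facet moment `∫_F ω n · κ`, with respect to the area measure, over the facet `F` opposite
the vertex `i`. -/
def facetMoment (T : Affine.Simplex ℝ E3 3) (z : E3) (ω : E3 → SymMat) (i : Fin 4)
    (κ : facet T i → Fin 3 → ℝ) : ℝ :=
  ∫ x : facet T i, normalTrace T z ω i x ⬝ᵥ κ x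
    ∂((Measure.euclideanHausdorffMeasure 2 : Measure E3).comap Subtype.val)

/-- The symmetric matrix `∫_T ω`, computed entrywise. -/
def matIntegral (T : Affine.Simplex ℝ E3 3) (ω : E3 → SymMat) : SymMat :=
  ⟨Matrix.of fun r c => ∫ x in tet T, (ω x).1 r c, by
    refine Matrix.IsSymm.ext fun r c => ?_
    simp only [Matrix.of_apply]
    refine integral_congr_ae (Filter.Eventually.of_forall fun x => ?_)
    exact Matrix.IsSymm.apply (ω x).2 r c⟩

end

/-! On each cell $T_i$ a field of $\Sigma_h(T)$ is an affine field $p_i$. Membership in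
$H(\mathrm{div})$ means exactly that the normal components of the four pieces agree across the six
interior faces. One direction is integration by parts, with interior fluxes cancelling in pairs
(`isWeakDiv_of_jumpFree`). The other tests with bump functions: in a cell they identify the weak
divergence (`weakDiv_ae_eq`), and at a face they isolate one jump (`jumpFree_of_isWeakDiv`). So
$\Sigma_h(T)$ is the kernel of a linear map from a space of dimension $4\cdot 24=96$ to one of
dimension $6\cdot 9=54$. Hence its dimension is at least 42 (`le_finrank_ker_jumpMap`). There are 42
degrees of freedom, so their injectivity (`dofMap_injective`) gives both the dimension and
unisolvence.

For injectivity let the facet moments vanish, so that $p_i\nabla\lambda_i=0$ on $F_i$. The face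
between $T_i$ and $T_j$ has normal $z_i\nabla\lambda_j-z_j\nabla\lambda_i$, where
$z_i=\lambda_i(z)$. If symmetric matrices $M_i$ at a common point satisfy the jump conditions and
$M_i\nabla\lambda_i=0$, then $z_iM_i\nabla\lambda_j=-z_jM_j\nabla\lambda_i$. Three such exchanges
around indices $i,j,l$, combined with symmetry, show that $\nabla\lambda_l\cdot M_i\nabla\lambda_j$
equals its own negative (`eq_zero_of_jump`). At the vertex $x_k$ this kills the three pieces meeting
there, so $p_i=\lambda_iA_i$ with a constant matrix $A_i$ (`piece_eq_lam_smul`).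

Then $\mathrm{div}\,p_i=A_i\nabla\lambda_i$. If all these vanish, the same algebra at $z$, where all
four cells meet, gives $p_i(z)=z_iA_i=0$ (`eq_zero_of_affDiv_eq_zero`); this is the divergence-free
statement. If instead $\int_T\omega=0$, then $\sum_i z_i\,p_i(z)=0$, because $\int_{T_i}\lambda_i$
is proportional to $z_i^2$. Summing the jump conditions at $z$ then forces $p_i(z)\nabla\lambda_i=0$
(`affDiv_eq_zero_of_sum_eq_zero`), which is the previous case. -/

noncomputable section

/-! ### Barycentric coordinates and the cones with apex z. -/

/-- The affine basis formed by the vertices of `T`. -/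
def vertexBasis (T : Affine.Simplex ℝ E3 3) : AffineBasis (Fin 4) ℝ E3 :=
  ⟨T.points, T.independent, by
    rw [T.independent.affineSpan_eq_top_iff_card_eq_finrank_add_one]; simp⟩

/-- The barycentric coordinate of `T` at the vertex `j`. -/
def lam (T : Affine.Simplex ℝ E3 3) (j : Fin 4) : E3 →ᵃ[ℝ] ℝ := (vertexBasis T).coord j

theorem lam_points (T : Affine.Simplex ℝ E3 3) (i j : Fin 4) :
    lam T i (T.points j) = if i = j then 1 else 0 :=
  (vertexBasis T).coord_apply i j

theorem sum_lam (T : Affine.Simplex ℝ E3 3) (y : E3) : ∑ j, lam T j y = 1 :=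
  (vertexBasis T).sum_coord_apply_eq_one y

theorem sum_lam_smul (T : Affine.Simplex ℝ E3 3) (y : E3) :
    ∑ j, lam T j y • T.points j = y :=
  (vertexBasis T).linear_combination_coord_eq_self y

theorem lam_continuous (T : Affine.Simplex ℝ E3 3) (j : Fin 4) : Continuous (lam T j) :=
  AffineMap.continuous_of_finiteDimensional _

theorem sum_lam_linear (T : Affine.Simplex ℝ E3 3) (v : E3) : ∑ j, (lam T j).linear v = 0 := by
  have h (j : Fin 4) : (lam T j).linear v = lam T j (v + 0) - lam T j 0 := by
    rw [← vadd_eq_add, AffineMap.map_vadd]; simp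
  simp only [h, Finset.sum_sub_distrib, sum_lam, sub_self]

theorem tet_eq_convexHull (T : Affine.Simplex ℝ E3 3) :
    tet T = convexHull ℝ (Set.range T.points) :=
  T.convexHull_eq_closedInterior.symm

theorem mem_tet_iff (T : Affine.Simplex ℝ E3 3) (y : E3) : y ∈ tet T ↔ ∀ j, 0 ≤ lam T j y := by
  rw [tet_eq_convexHull]
  exact Set.ext_iff.1 (AffineBasis.convexHull_eq_nonneg_coord (vertexBasis T)) y

theorem interior_tet (T : Affine.Simplex ℝ E3 3) : interior (tet T) = {y | ∀ j, 0 < lam T j y} := by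
  rw [tet_eq_convexHull]
  exact AffineBasis.interior_convexHull (vertexBasis T)

theorem affineCombination_lam (T : Affine.Simplex ℝ E3 3) (y : E3) :
    Finset.univ.affineCombination ℝ T.points (fun j => lam T j y) = y :=
  (vertexBasis T).affineCombination_coord_eq_self y

theorem lam_pos_of_mem_interior {T : Affine.Simplex ℝ E3 3} {z : E3} (hz : z ∈ T.interior)
    (j : Fin 4) : 0 < lam T j z := by
  rw [← affineCombination_lam T z,
    Affine.Simplex.affineCombination_mem_interior_iff (sum_lam T z)] at hz
  exact (hz j).1

theorem mem_facet_iff (T : Affine.Simplex ℝ E3 3) (i : Fin 4) (y : E3) :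
    y ∈ facet T i ↔ lam T i y = 0 ∧ ∀ j, 0 ≤ lam T j y := by
  have := T.affineCombination_mem_closedInterior_face_iff_nonneg (fs := {i}ᶜ) (m := 2)
    (by simp [Finset.card_compl]) (sum_lam T y)
  rw [affineCombination_lam] at this
  refine this.trans ⟨fun h => ⟨h.2 i (by simp), fun j => ?_⟩, fun h => ⟨fun j _ => h.2 j, ?_⟩⟩
  · by_cases hj : j = i
    · exact (h.2 j (by simp [hj])).ge
    · exact h.1 j (by simp [hj])
  · intro j hj
    obtain rfl : j = i := by simpa using hj
    exact h.1

/-- The closed cone with apex `z` over the facet opposite the vertex `i`. -/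
def sec (T : Affine.Simplex ℝ E3 3) (z : E3) (i : Fin 4) : Set E3 :=
  {y | ∀ j, lam T i y * lam T j z ≤ lam T j y * lam T i z}

/-- The open cone with apex `z` over the facet opposite the vertex `i`. -/
def openSec (T : Affine.Simplex ℝ E3 3) (z : E3) (i : Fin 4) : Set E3 :=
  {y | ∀ j, j ≠ i → lam T i y * lam T j z < lam T j y * lam T i z}

theorem isOpen_openSec (T : Affine.Simplex ℝ E3 3) (z : E3) (i : Fin 4) :
    IsOpen (openSec T z i) := by
  simp only [openSec, Set.ofPred_forall]
  refine isOpen_iInter_of_finite fun j => isOpen_iInter_of_finite fun _ => isOpen_lt ?_ ?_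
  · exact (lam_continuous T i).mul continuous_const
  · exact (lam_continuous T j).mul continuous_const

theorem isClosed_sec (T : Affine.Simplex ℝ E3 3) (z : E3) (i : Fin 4) :
    IsClosed (sec T z i) := by
  simp only [sec, Set.ofPred_forall]
  refine isClosed_iInter fun j => isClosed_le ?_ ?_
  · exact (lam_continuous T i).mul continuous_const
  · exact (lam_continuous T j).mul continuous_const

theorem openSec_subset_sec (T : Affine.Simplex ℝ E3 3) (z : E3) (i : Fin 4) :
    openSec T z i ⊆ sec T z i := by
  intro y hy j
  by_cases h : j = i
  · rw [h]
  · exact (hy j h).le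

theorem disjoint_openSec (T : Affine.Simplex ℝ E3 3) (z : E3) {i j : Fin 4} (h : i ≠ j) :
    Disjoint (openSec T z i) (openSec T z j) :=
  Set.disjoint_left.2 fun _ hi hj => lt_asymm (hi j h.symm) (hj i h)

theorem disjoint_openSec_sec (T : Affine.Simplex ℝ E3 3) (z : E3) {i j : Fin 4} (h : i ≠ j) :
    Disjoint (openSec T z i) (sec T z j) :=
  Set.disjoint_left.2 fun _ hi hj => not_le_of_gt (hi j h.symm) (hj i)

/-- The cone inequalities are affine in `y`, so they need checking only at the vertices of the cell;
conversely they say that the barycentric coordinates of `y` relative to the cell are nonnegative. -/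
theorem mem_alfeldTet_iff {T : Affine.Simplex ℝ E3 3} {z : E3} (hz : z ∈ T.interior) (i : Fin 4)
    (y : E3) : y ∈ alfeldTet T z i ↔ y ∈ tet T ∧ y ∈ sec T z i := by
  have hpos := lam_pos_of_mem_interior hz
  constructor
  · refine fun h => ⟨alfeldTet_subset (T.interior_subset_closedInterior hz) i h, fun j => ?_⟩
    have hc : Convex ℝ {y : E3 | (lam T i z • lam T j - lam T j z • lam T i) y ∈ Set.Ici (0 : ℝ)} :=
      (convex_Ici (0 : ℝ)).affine_preimage _
    have : y ∈ {y : E3 | (lam T i z • lam T j - lam T j z • lam T i) y ∈ Set.Ici (0 : ℝ)} := by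
      refine convexHull_min ?_ hc h
      rintro _ ⟨k, rfl⟩
      by_cases hk : k = i
      · subst hk; simp [mul_comm]
      · rw [Function.update_of_ne hk]
        simp only [Set.mem_ofPred_eq, Set.mem_Ici, AffineMap.coe_sub, AffineMap.coe_smul,
          Pi.sub_apply, Pi.smul_apply, smul_eq_mul, lam_points, if_neg (Ne.symm hk)]
        split_ifs <;> simp [(hpos i).le]
    simp only [Set.mem_ofPred_eq, Set.mem_Ici, AffineMap.coe_sub, AffineMap.coe_smul,
          Pi.sub_apply, Pi.smul_apply, smul_eq_mul] at this
    linarith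
  · rintro ⟨h1, h2⟩
    rw [mem_tet_iff] at h1
    -- The coordinates of `y` in the cell: the apex carries $t=\lambda_i(y)/\lambda_i(z)$, and
    -- subtracting $tz$ leaves $\lambda_j(y)-t\lambda_j(z)$ on the other vertices. At `j = i` the
    -- first summand is zero.
    set w : Fin 4 → ℝ := fun j => (lam T j y - lam T j z * (lam T i y / lam T i z)) +
      if j = i then lam T i y / lam T i z else 0 with hw
    have e : ∑ j, w j • Function.update T.points i z j = y := by
      have : ∀ j, w j • Function.update T.points i z j =
          (lam T j y • T.points j - (lam T i y / lam T i z) • lam T j z • T.points j) +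
            if j = i then (lam T i y / lam T i z) • z else 0 := by
        intro j
        by_cases hj : j = i
        · subst hj
          simp only [hw, Function.update_self, if_true]
          rw [mul_div_cancel₀ _ (hpos j).ne', smul_smul, div_mul_cancel₀ _ (hpos j).ne']
          simp
        · simp only [hw, Function.update_of_ne hj, if_neg hj, add_zero, sub_smul, smul_smul,
            mul_comm]
      rw [Finset.sum_congr rfl fun j _ => this j, Finset.sum_add_distrib, Finset.sum_sub_distrib,
        ← Finset.smul_sum, sum_lam_smul, sum_lam_smul]
      simp
    rw [← e]
    refine (convex_convexHull ℝ _).sum_mem (fun j _ => ?_) ?_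
      fun j _ => subset_convexHull ℝ _ ⟨j, rfl⟩
    · simp only [hw]
      have a1 := h2 j
      have a2 : 0 ≤ lam T j y - lam T j z * (lam T i y / lam T i z) := by
        rw [sub_nonneg, ← mul_div_assoc, div_le_iff₀ (hpos i)]; linarith
      split_ifs
      · exact add_nonneg a2 (div_nonneg (h1 i) (hpos i).le)
      · simpa using a2
    · simp only [hw, Finset.sum_add_distrib, Finset.sum_sub_distrib, ← Finset.sum_mul, sum_lam]
      simp

theorem alfeldTet_eq {T : Affine.Simplex ℝ E3 3} {z : E3} (hz : z ∈ T.interior) (i : Fin 4) :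
    alfeldTet T z i = tet T ∩ sec T z i :=
  Set.ext fun y => mem_alfeldTet_iff hz i y

/-! ### Interior faces: normals and symmetric parametrizations. -/

/-- The functional `v ↦ z_i (∇λ_j · v) - z_j (∇λ_i · v)`, normal to the common face of the
cones opposite the vertices `i` and `j`. -/
def faceNormal (T : Affine.Simplex ℝ E3 3) (z : E3) (i j : Fin 4) : E3 →ₗ[ℝ] ℝ :=
  lam T i z • (lam T j).linear - lam T j z • (lam T i).linear

theorem faceNormal_apply (T : Affine.Simplex ℝ E3 3) (z : E3) (i j : Fin 4) (v : E3) :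
    faceNormal T z i j v = lam T i z * (lam T j).linear v - lam T j z * (lam T i).linear v := rfl

theorem faceNormal_swap (T : Affine.Simplex ℝ E3 3) (z : E3) (i j : Fin 4) (v : E3) :
    faceNormal T z j i v = -faceNormal T z i j v := by
  simp only [faceNormal_apply]; ring

theorem faceNormal_self (T : Affine.Simplex ℝ E3 3) (z : E3) (i : Fin 4) :
    faceNormal T z i i = 0 := sub_self _

/-- The two indices other than `i` and `j`, in increasing order. -/
def faceIdx (i j : Fin 4) (n : Fin 2) : Fin 4 :=
  match finSuccEquiv' i j with
  | some m => i.succAbove (m.succAbove n)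
  -- A default for `i = j`; it is harmless because `faceNormal T z i i` vanishes.
  | none => i

theorem faceIdx_succAbove (i : Fin 4) (m : Fin 3) (n : Fin 2) :
    faceIdx i (i.succAbove m) n = i.succAbove (m.succAbove n) := by
  simp [faceIdx]

theorem faceIdx_comm (i j : Fin 4) (n : Fin 2) (h : i ≠ j) : faceIdx i j n = faceIdx j i n := by
  revert i j n; decide

theorem faceIdx_ne_left (i j : Fin 4) (n : Fin 2) (h : i ≠ j) : faceIdx i j n ≠ i := by
  revert i j n; decide

theorem faceIdx_ne_right (i j : Fin 4) (n : Fin 2) (h : i ≠ j) : faceIdx i j n ≠ j := by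
  revert i j n; decide

theorem eq_or_eq_faceIdx (i j k : Fin 4) (h : i ≠ j) :
    k = i ∨ k = j ∨ ∃ n, k = faceIdx i j n := by
  revert i j k; decide

/-- The parametrization of the plane through the common face of the cones opposite the vertices
`i` and `j`. -/
def facePoint (T : Affine.Simplex ℝ E3 3) (z : E3) (i j : Fin 4) (η : Fin 2 → ℝ) : E3 :=
  z + ∑ n, η n • (T.points (faceIdx i j n) - z)

theorem facePoint_comm (T : Affine.Simplex ℝ E3 3) (z : E3) {i j : Fin 4} (h : i ≠ j) :
    facePoint T z i j = facePoint T z j i := by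
  funext η; simp only [facePoint, faceIdx_comm i j _ h]

theorem facePoint_continuous (T : Affine.Simplex ℝ E3 3) (z : E3) (i j : Fin 4) :
    Continuous (facePoint T z i j) := by
  unfold facePoint; fun_prop

/-- The base point and the family of vertices are left free so that one computation serves the
cones, the interior faces and the facets. -/
theorem lam_add_sum (T : Affine.Simplex ℝ E3 3) (z : E3) {ι : Type*} [Fintype ι] (η : ι → ℝ)
    (f : ι → Fin 4) (k : Fin 4) :
    lam T k (z + ∑ n, η n • (T.points (f n) - z)) =
      lam T k z * (1 - ∑ n, η n) + ∑ n, if k = f n then η n else 0 := by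
  have h : ∀ n, (lam T k).linear (T.points (f n) - z) = (if k = f n then 1 else 0) - lam T k z := by
    intro n
    rw [← lam_points, ← vsub_eq_sub, AffineMap.linearMap_vsub, vsub_eq_sub]
  rw [add_comm z, ← vadd_eq_add, AffineMap.map_vadd, map_sum]
  simp only [map_smul, h, smul_eq_mul, vadd_eq_add, mul_sub, Finset.sum_sub_distrib, mul_ite,
    mul_one, mul_zero, ← Finset.sum_mul]
  ring

/-! ### Affine coordinates on a cone and their Jacobian. -/

/-- The affine parametrization of space by the cone opposite the vertex `i`: the nonnegative
orthant is mapped onto the cone. -/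
def secParam (T : Affine.Simplex ℝ E3 3) (z : E3) (i : Fin 4) (ξ : Fin 3 → ℝ) : E3 :=
  z + ∑ m, ξ m • (T.points (i.succAbove m) - z)

theorem secParam_continuous (T : Affine.Simplex ℝ E3 3) (z : E3) (i : Fin 4) :
    Continuous (secParam T z i) := by
  unfold secParam; fun_prop

theorem lam_secParam_self (T : Affine.Simplex ℝ E3 3) (z : E3) (i : Fin 4) (ξ : Fin 3 → ℝ) :
    lam T i (secParam T z i ξ) = lam T i z * (1 - ∑ m, ξ m) := by
  rw [secParam, lam_add_sum]
  simp [(Fin.succAbove_ne i _).symm]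

theorem lam_secParam_succAbove (T : Affine.Simplex ℝ E3 3) (z : E3) (i : Fin 4) (ξ : Fin 3 → ℝ)
    (m : Fin 3) :
    lam T (i.succAbove m) (secParam T z i ξ) =
      lam T (i.succAbove m) z * (1 - ∑ m, ξ m) + ξ m := by
  rw [secParam, lam_add_sum]
  simp

theorem secParam_injective {T : Affine.Simplex ℝ E3 3} {z : E3} (hz : z ∈ T.interior)
    (i : Fin 4) : Function.Injective (secParam T z i) := by
  intro ξ ξ' h
  have h1 := congrArg (lam T i) h
  rw [lam_secParam_self, lam_secParam_self] at h1
  have h2 := mul_left_cancel₀ (lam_pos_of_mem_interior hz i).ne' h1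
  funext m
  have h3 := congrArg (lam T (i.succAbove m)) h
  rw [lam_secParam_succAbove, lam_secParam_succAbove, h2] at h3
  exact add_left_cancel h3

theorem secParam_preimage_sec {T : Affine.Simplex ℝ E3 3} {z : E3} (hz : z ∈ T.interior)
    (i : Fin 4) : secParam T z i ⁻¹' sec T z i = Set.Ici 0 := by
  have hpos := lam_pos_of_mem_interior hz
  ext ξ
  simp only [Set.mem_preimage, sec, Set.mem_ofPred_eq, Set.mem_Ici, Pi.le_def, Pi.zero_apply,
    Fin.forall_iff_succAbove i, le_refl, true_and, lam_secParam_self, lam_secParam_succAbove]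
  refine forall_congr' fun m => ?_
  have : (lam T (i.succAbove m) z * (1 - ∑ m, ξ m) + ξ m) * lam T i z =
      lam T i z * (1 - ∑ m, ξ m) * lam T (i.succAbove m) z + lam T i z * ξ m := by ring
  rw [this, le_add_iff_nonneg_right, mul_nonneg_iff_of_pos_left (hpos i)]

/-- The matrix of the linear part of `secParam`. -/
def secMatrix (T : Affine.Simplex ℝ E3 3) (z : E3) (i : Fin 4) : Matrix (Fin 3) (Fin 3) ℝ :=
  Matrix.of fun c m => (T.points (i.succAbove m) - z) c

theorem ofLp_secParam (T : Affine.Simplex ℝ E3 3) (z : E3) (i : Fin 4) (ξ : Fin 3 → ℝ) :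
    (secParam T z i ξ).ofLp = z.ofLp + secMatrix T z i *ᵥ ξ := by
  ext c
  simp [secParam, secMatrix, Matrix.mulVec, dotProduct, mul_comm]

theorem secMatrix_det_ne_zero {T : Affine.Simplex ℝ E3 3} {z : E3} (hz : z ∈ T.interior)
    (i : Fin 4) : (secMatrix T z i).det ≠ 0 := by
  rw [← isUnit_iff_ne_zero, ← Matrix.isUnit_iff_isUnit_det, ← Matrix.mulVec_injective_iff_isUnit]
  intro ξ ξ' h
  refine secParam_injective hz i (WithLp.ofLp_injective 2 ?_)
  rw [ofLp_secParam, ofLp_secParam, h]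

theorem isClosedEmbedding_secParam {T : Affine.Simplex ℝ E3 3} {z : E3} (hz : z ∈ T.interior)
    (i : Fin 4) : Topology.IsClosedEmbedding (secParam T z i) := by
  have hm : Continuous fun y : E3 => (secMatrix T z i)⁻¹ *ᵥ (y - z).ofLp := by fun_prop
  refine Function.LeftInverse.isClosedEmbedding (f := fun y : E3 =>
    (secMatrix T z i)⁻¹ *ᵥ (y - z).ofLp) (fun ξ => ?_) hm (secParam_continuous T z i)
  simp only [WithLp.ofLp_sub, ofLp_secParam, add_sub_cancel_left, Matrix.mulVec_mulVec]
  rw [Matrix.nonsing_inv_mul _ (isUnit_iff_ne_zero.2 (secMatrix_det_ne_zero hz i)),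
    Matrix.one_mulVec]

/-- Cramer's rule for the relation $\sum_j\lambda_j(z)(x_j-z)=0$: the volumes of the cells are
proportional to the barycentric coordinates of $z$. Hence one factor, independent of `i`, normalizes
all four cones, which is what lets fluxes from different cells cancel. -/
theorem mul_secMatrix_det {T : Affine.Simplex ℝ E3 3} {z : E3} (hz : z ∈ T.interior) (i : Fin 4) :
    lam T 0 z * |(secMatrix T z i).det| = lam T i z * |(secMatrix T z 0).det| := by
  have hpos := lam_pos_of_mem_interior hz
  have key (c : Fin 3) : ∑ j, lam T j z * (T.points j - z) c = 0 := by
    have h := congrArg (fun v : E3 => v c) (sum_lam_smul T z)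
    simp only [WithLp.ofLp_sum, WithLp.ofLp_smul, Finset.sum_apply, Pi.smul_apply,
      smul_eq_mul] at h
    simp only [PiLp.sub_apply, mul_sub, Finset.sum_sub_distrib, ← Finset.sum_mul, sum_lam, h]
    ring
  simp only [Fin.sum_univ_four] at key
  have h0 := key 0
  have h1 := key 1
  have h2 := key 2
  set w := fun (j : Fin 4) (c : Fin 3) => (T.points j - z) c with hw
  have hdet (i : Fin 4) : (secMatrix T z i).det =
      Matrix.det (Matrix.of fun c m => w (i.succAbove m) c) := rfl
  change _ * w 0 0 + _ * w 1 0 + _ * w 2 0 + _ * w 3 0 = 0 at h0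
  change _ * w 0 1 + _ * w 1 1 + _ * w 2 1 + _ * w 3 1 = 0 at h1
  change _ * w 0 2 + _ * w 1 2 + _ * w 2 2 + _ * w 3 2 = 0 at h2
  rw [hdet, hdet, ← abs_of_pos (hpos 0), ← abs_of_pos (hpos i), ← abs_mul, ← abs_mul]
  clear_value w
  have e10 : (1 : Fin 4).succAbove (0 : Fin 3) = 0 := rfl
  have e11 : (1 : Fin 4).succAbove (1 : Fin 3) = 2 := rfl
  have e12 : (1 : Fin 4).succAbove (2 : Fin 3) = 3 := rfl
  have e20 : (2 : Fin 4).succAbove (0 : Fin 3) = 0 := rfl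
  have e21 : (2 : Fin 4).succAbove (1 : Fin 3) = 1 := rfl
  have e22 : (2 : Fin 4).succAbove (2 : Fin 3) = 3 := rfl
  have e30 : (3 : Fin 4).succAbove (0 : Fin 3) = 0 := rfl
  have e31 : (3 : Fin 4).succAbove (1 : Fin 3) = 1 := rfl
  have e32 : (3 : Fin 4).succAbove (2 : Fin 3) = 2 := rfl
  have e00 : (0 : Fin 4).succAbove (0 : Fin 3) = 1 := rfl
  have e01 : (0 : Fin 4).succAbove (1 : Fin 3) = 2 := rfl
  have e02 : (0 : Fin 4).succAbove (2 : Fin 3) = 3 := rfl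
  -- The relation is paired with the cross product of the two edges common to both determinants. The
  -- order of the columns makes the signs opposite for `i = 1` and `i = 3`.
  simp only [Matrix.det_fin_three, Matrix.of_apply]
  fin_cases i
  · rfl
  · rw [← abs_neg (lam T _ z * _)]
    congr 1
    simp only [Fin.mk_one, e00, e01, e02, e10, e11, e12]
    linear_combination (w 2 2 * w 3 1 - w 2 1 * w 3 2) * h0 + (w 2 0 * w 3 2 - w 2 2 * w 3 0) * h1
      + (w 2 1 * w 3 0 - w 2 0 * w 3 1) * h2
  · congr 1
    simp only [Fin.reduceFinMk, e00, e01, e02, e20, e21, e22]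
    linear_combination (w 1 1 * w 3 2 - w 1 2 * w 3 1) * h0 + (w 1 2 * w 3 0 - w 1 0 * w 3 2) * h1
      + (w 1 0 * w 3 1 - w 1 1 * w 3 0) * h2
  · rw [← abs_neg (lam T _ z * _)]
    congr 1
    simp only [Fin.reduceFinMk, e00, e01, e02, e30, e31, e32]
    linear_combination (w 1 2 * w 2 1 - w 1 1 * w 2 2) * h0 + (w 1 0 * w 2 2 - w 1 2 * w 2 0) * h1
      + (w 1 1 * w 2 0 - w 1 0 * w 2 1) * h2

/-- Six times the volume of `T`. -/
def volFactor (T : Affine.Simplex ℝ E3 3) (z : E3) : ℝ :=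
  |(secMatrix T z 0).det| / lam T 0 z

theorem volFactor_pos {T : Affine.Simplex ℝ E3 3} {z : E3} (hz : z ∈ T.interior) :
    0 < volFactor T z :=
  div_pos (abs_pos.2 (secMatrix_det_ne_zero hz 0)) (lam_pos_of_mem_interior hz 0)

theorem abs_secMatrix_det {T : Affine.Simplex ℝ E3 3} {z : E3} (hz : z ∈ T.interior)
    (i : Fin 4) : |(secMatrix T z i).det| = lam T i z * volFactor T z := by
  rw [volFactor, ← mul_div_assoc, eq_div_iff (lam_pos_of_mem_interior hz 0).ne', mul_comm,
    mul_secMatrix_det hz]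

theorem map_secParam {T : Affine.Simplex ℝ E3 3} {z : E3} (hz : z ∈ T.interior) (i : Fin 4) :
    Measure.map (secParam T z i) volume =
      ENNReal.ofReal (lam T i z * volFactor T z)⁻¹ • (volume : Measure E3) := by
  have h1 := Real.map_matrix_volume_pi_eq_smul_volume_pi (secMatrix_det_ne_zero hz i)
  have e : secParam T z i = (fun v => z + v) ∘ WithLp.toLp 2 ∘
      (Matrix.toLin' (secMatrix T z i)) := by
    funext ξ
    refine WithLp.ofLp_injective 2 ?_
    rw [ofLp_secParam]
    simp
  have hm : Measurable (Matrix.toLin' (secMatrix T z i)) :=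
    (LinearMap.continuous_of_finiteDimensional _).measurable
  rw [e, ← Measure.map_map (measurable_const_add z) 
      ((WithLp.measurable_toLp 2 _).comp hm),
    ← Measure.map_map (WithLp.measurable_toLp 2 _) hm, h1, Measure.map_smul, Measure.map_smul,
    (PiLp.volume_preserving_toLp (Fin 3)).map_eq, map_add_left_eq_self, abs_inv,
    abs_secMatrix_det hz]

theorem setIntegral_sec {T : Affine.Simplex ℝ E3 3} {z : E3} (hz : z ∈ T.interior) (i : Fin 4)
    (f : E3 → ℝ) :
    ∫ y in sec T z i, f y =
      lam T i z * volFactor T z * ∫ ξ in Set.Ici 0, f (secParam T z i ξ) := by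
  have hc : 0 < lam T i z * volFactor T z :=
    mul_pos (lam_pos_of_mem_interior hz i) (volFactor_pos hz)
  have he : MeasurableEmbedding (secParam T z i) :=
    (secParam_continuous T z i).measurableEmbedding (secParam_injective hz i)
  rw [← secParam_preimage_sec hz i, ← he.setIntegral_map, map_secParam hz, Measure.restrict_smul,
    integral_smul_measure, ENNReal.toReal_ofReal (inv_pos.2 hc).le, smul_eq_mul,
    mul_inv_cancel_left₀ hc.ne']

/-! ### The divergence theorem on a cone. -/

theorem secParam_insertNth (T : Affine.Simplex ℝ E3 3) (z : E3) (i : Fin 4) (m : Fin 3)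
    (η : Fin 2 → ℝ) :
    secParam T z i (m.insertNth 0 η) = facePoint T z i (i.succAbove m) η := by
  simp [secParam, facePoint, Fin.sum_univ_succAbove _ m, faceIdx_succAbove]

/-- Every vector, expanded along the edges of the cone opposite the vertex `i`. -/
theorem sum_faceNormal_smul (T : Affine.Simplex ℝ E3 3) (z : E3) (i : Fin 4) (v : E3) :
    ∑ m : Fin 3, faceNormal T z i (i.succAbove m) v • (T.points (i.succAbove m) - z) =
      lam T i z • v := by
  have hv : ∑ j, (lam T j).linear v • T.points j = v := by
    have h1 := sum_lam_smul T (v + z)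
    have h2 (j : Fin 4) : lam T j (v + z) = (lam T j).linear v + lam T j z := by
      rw [← vadd_eq_add, AffineMap.map_vadd, vadd_eq_add]
    simp only [h2, add_smul, Finset.sum_add_distrib, sum_lam_smul] at h1
    exact add_right_cancel h1
  have h : ∑ j, faceNormal T z i j v • (T.points j - z) = lam T i z • v := by
    simp only [faceNormal_apply, sub_smul, smul_sub, Finset.sum_sub_distrib, mul_smul,
      ← Finset.smul_sum, ← Finset.sum_smul, sum_lam_linear, sum_lam, hv,
      smul_comm _ ((lam T i).linear v), sum_lam_smul]
    simp
  rw [Fin.sum_univ_succAbove _ i, faceNormal_self] at h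
  simpa using h

/-- In the cone coordinates the domain is an orthant. Compact support allows it to be replaced by a
large cube, and the divergence theorem on the cube leaves only the three faces through the apex. -/
theorem setIntegral_sec_fderiv {T : Affine.Simplex ℝ E3 3} {z : E3} (hz : z ∈ T.interior)
    (i : Fin 4) {θ : E3 → ℝ} (hθ : ContDiff ℝ 1 θ) (hc : HasCompactSupport θ) (v : E3) :
    ∫ y in sec T z i, fderiv ℝ θ y v =
      -(volFactor T z * ∑ m : Fin 3, faceNormal T z i (i.succAbove m) v *
        ∫ η in Set.Ici 0, θ (facePoint T z i (i.succAbove m) η)) := by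
  have hpos := lam_pos_of_mem_interior hz i
  set L := secParam T z i with hL
  set w : Fin 3 → E3 := fun m => T.points (i.succAbove m) - z with hw
  obtain ⟨R, hR0, hR⟩ : ∃ R : ℝ, 0 ≤ R ∧ ∀ ξ : Fin 3 → ℝ, R ≤ ‖ξ‖ → L ξ ∉ tsupport θ := by
    have he : Topology.IsClosedEmbedding L := isClosedEmbedding_secParam hz i
    have hK : IsCompact (L ⁻¹' tsupport θ) := he.isCompact_preimage hc
    obtain ⟨R, hR⟩ := hK.isBounded.exists_norm_le
    refine ⟨max R 0 + 1, by positivity, fun ξ h1 h2 => ?_⟩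
    have := hR ξ h2
    have := le_max_left R 0
    linarith
  have hR' : ∀ ξ : Fin 3 → ℝ, (∃ m, R ≤ ξ m) → L ξ ∉ tsupport θ := fun ξ ⟨m, hm⟩ =>
    hR ξ (hm.trans ((le_abs_self _).trans (norm_le_pi_norm ξ m)))
  have hLd (ξ : Fin 3 → ℝ) : HasFDerivAt L (∑ m, (ContinuousLinearMap.proj m :
      (Fin 3 → ℝ) →L[ℝ] ℝ).smulRight (w m)) ξ := by
    have h (m : Fin 3) : HasFDerivAt (fun ξ : Fin 3 → ℝ => ξ m • w m)
        ((ContinuousLinearMap.proj m : (Fin 3 → ℝ) →L[ℝ] ℝ).smulRight (w m)) ξ :=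
      ((ContinuousLinearMap.proj m : (Fin 3 → ℝ) →L[ℝ] ℝ).smulRight (w m)).hasFDerivAt
    exact HasFDerivAt.const_add z (HasFDerivAt.fun_sum fun m _ => h m)
  have hθd (y : E3) : HasFDerivAt θ (fderiv ℝ θ y) y :=
    (hθ.differentiable one_ne_zero y).hasFDerivAt
  have hθc : Continuous (fderiv ℝ θ) := hθ.continuous_fderiv one_ne_zero
  -- The coefficients of the field are the coordinates of $\lambda_i(z)v$ along the edges of the
  -- cone, so its divergence is $\lambda_i(z)\,\partial_v\theta$.
  have key := integral_divergence_of_hasFDerivAt_off_countable' (n := 2) (E := ℝ)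
    (0 : Fin 3 → ℝ) (fun _ => R) (fun _ => hR0)
    (fun m ξ => faceNormal T z i (i.succAbove m) v * θ (L ξ))
    (fun m ξ => faceNormal T z i (i.succAbove m) v • (fderiv ℝ θ (L ξ)).comp
      (∑ m, (ContinuousLinearMap.proj m : (Fin 3 → ℝ) →L[ℝ] ℝ).smulRight (w m)))
    ∅ Set.countable_empty
    (fun m => ((hθ.continuous.comp (secParam_continuous T z i)).const_mul _).continuousOn)
    (fun ξ _ m => ((hθd (L ξ)).comp ξ (hLd ξ)).const_mul _)
    (by
      refine Continuous.integrableOn_Icc (continuous_finsetSum _ fun m _ => ?_)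
      have := hθc.comp (secParam_continuous T z i)
      simp only [smul_apply, ContinuousLinearMap.comp_apply]
      exact continuous_const.mul (this.clm_apply continuous_const))
  have e1 (ξ : Fin 3 → ℝ) : ∑ m, (faceNormal T z i (i.succAbove m) v •
      (fderiv ℝ θ (L ξ)).comp (∑ m, (ContinuousLinearMap.proj m :
        (Fin 3 → ℝ) →L[ℝ] ℝ).smulRight (w m))) (Pi.single m 1) =
      lam T i z * fderiv ℝ θ (L ξ) v := by
    have e2 (m : Fin 3) : (∑ k, (ContinuousLinearMap.proj k :
        (Fin 3 → ℝ) →L[ℝ] ℝ).smulRight (w k)) (Pi.single m 1) = w m := by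
      simp [Pi.single_apply]
    simp only [smul_apply, ContinuousLinearMap.comp_apply, e2]
    rw [← smul_eq_mul (lam T i z), ← map_smul, ← sum_faceNormal_smul T z i v, map_sum]
    simp only [map_smul, hw]
  have hzero (ξ : Fin 3 → ℝ) (h : L ξ ∉ tsupport θ) : fderiv ℝ θ (L ξ) v = 0 := by
    rw [fderiv_of_notMem_tsupport _ h]; rfl
  simp only [e1, integral_const_mul] at key
  rw [setIntegral_sec hz]
  have hbox {n : ℕ} (f : (Fin n → ℝ) → ℝ) (hf : ∀ ξ, (∃ m, R ≤ ξ m) → f ξ = 0) :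
      ∫ ξ in Set.Icc 0 (fun _ => R), f ξ = ∫ ξ in Set.Ici 0, f ξ := by
    refine (setIntegral_eq_of_subset_of_forall_sdiff_eq_zero measurableSet_Ici
      (fun ξ h => h.1) fun ξ h => hf ξ ?_).symm
    by_contra hcon
    push Not at hcon
    exact h.2 ⟨h.1, fun m => (hcon m).le⟩
  rw [hbox _ fun ξ hξ => hzero ξ (hR' ξ hξ)] at key
  rw [mul_comm (lam T i z), mul_assoc, key, ← mul_neg, ← Finset.sum_neg_distrib]
  congr 1
  refine Finset.sum_congr rfl fun m _ => ?_
  have hz0 (ξ : Fin 3 → ℝ) (h : L ξ ∉ tsupport θ) : θ (L ξ) = 0 := image_eq_zero_of_notMem_tsupport h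
  have hfront (η : Fin 2 → ℝ) : θ (L (m.insertNth R η)) = 0 :=
    hz0 _ (hR' _ ⟨m, by simp⟩)
  simp only [hfront, mul_zero, integral_zero, zero_sub]
  congr 2
  have := hbox (fun η : Fin 2 → ℝ => θ (L (m.insertNth 0 η))) fun η ⟨n, hn⟩ =>
    hz0 _ (hR' _ ⟨m.succAbove n, by simpa using hn⟩)
  simp only [hL, Pi.zero_apply, secParam_insertNth] at this ⊢
  exact this

theorem isClosedEmbedding_facePoint {T : Affine.Simplex ℝ E3 3} {z : E3} (hz : z ∈ T.interior)
    {i j : Fin 4} (h : i ≠ j) : Topology.IsClosedEmbedding (facePoint T z i j) := by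
  obtain ⟨m, rfl⟩ := Fin.exists_succAbove_eq h.symm
  have h1 : Topology.IsClosedEmbedding (fun η : Fin 2 → ℝ => m.insertNth (α := fun _ => ℝ) 0 η) := by
    refine Function.LeftInverse.isClosedEmbedding (f := fun ξ : Fin 3 → ℝ => m.removeNth ξ)
      (fun η => ?_) ?_ ?_
    · simp
    · exact continuous_pi fun n => continuous_apply _
    · exact continuous_const.finInsertNth m continuous_id
  have h2 : facePoint T z i (i.succAbove m) =
      secParam T z i ∘ fun η : Fin 2 → ℝ => m.insertNth (α := fun _ => ℝ) 0 η :=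
    funext fun η => (secParam_insertNth T z i m η).symm
  rw [h2]
  exact (isClosedEmbedding_secParam hz i).comp h1

/-! ### Decomposition of T into the four cells up to null sets. -/

theorem sec_sdiff_openSec_subset (T : Affine.Simplex ℝ E3 3) (z : E3) (i : Fin 4) :
    sec T z i \ openSec T z i ⊆ ⋃ j : {j : Fin 4 // j ≠ i},
      {y | lam T i y * lam T j z = lam T j y * lam T i z} := by
  rintro y ⟨h1, h2⟩
  simp only [openSec, Set.mem_ofPred_eq, not_forall, not_lt] at h2
  obtain ⟨j, hj, h3⟩ := h2
  exact Set.mem_iUnion.2 ⟨⟨j, hj⟩, le_antisymm (h1 j) h3⟩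

theorem volume_splitting_plane {T : Affine.Simplex ℝ E3 3} {z : E3} (hz : z ∈ T.interior)
    {i j : Fin 4} (h : j ≠ i) :
    volume {y | lam T i y * lam T j z = lam T j y * lam T i z} = 0 := by
  set g : E3 →ᵃ[ℝ] ℝ := lam T j z • lam T i - lam T i z • lam T j with hg
  have key := Measure.addHaar_affineSubspace (volume : Measure E3)
    ((AffineSubspace.mk' (0 : ℝ) ⊥).comap g) (by
      -- The plane is proper because it misses $x_i$: there the two sides are $\lambda_j(z)>0$ and
      -- $0$.
      intro htop
      have h1 : T.points i ∈ (AffineSubspace.mk' (0 : ℝ) ⊥).comap g := htop ▸ AffineSubspace.mem_top ..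
      simp [hg, lam_points, h, (lam_pos_of_mem_interior hz j).ne'] at h1)
  refine measure_mono_null (fun y hy => ?_) key
  have hy' : lam T i y * lam T j z = lam T j y * lam T i z := hy
  simp only [SetLike.mem_coe, AffineSubspace.mem_comap, AffineSubspace.mem_mk', vsub_eq_sub, sub_zero,
    Submodule.mem_bot, hg, AffineMap.coe_sub, AffineMap.coe_smul, Pi.sub_apply, Pi.smul_apply,
    smul_eq_mul]
  linarith

theorem openSec_ae_eq_sec {T : Affine.Simplex ℝ E3 3} {z : E3} (hz : z ∈ T.interior) (i : Fin 4) :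
    openSec T z i =ᵐ[volume] sec T z i := by
  refine (openSec_subset_sec T z i).eventuallyLE.antisymm ?_
  rw [ae_le_set]
  refine measure_mono_null (sec_sdiff_openSec_subset T z i) (measure_iUnion_null fun j => ?_)
  exact volume_splitting_plane hz j.2

theorem convex_tet (T : Affine.Simplex ℝ E3 3) : Convex ℝ (tet T) := by
  rw [tet_eq_convexHull]; exact convex_convexHull ℝ _

theorem isCompact_tet (T : Affine.Simplex ℝ E3 3) : IsCompact (tet T) := by
  rw [tet_eq_convexHull]; exact (Set.finite_range _).isCompact_convexHull ℝ

theorem isCompact_alfeldTet (T : Affine.Simplex ℝ E3 3) (z : E3) (i : Fin 4) :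
    IsCompact (alfeldTet T z i) :=
  (Set.finite_range _).isCompact_convexHull ℝ

theorem interior_tet_ae_eq (T : Affine.Simplex ℝ E3 3) : interior (tet T) =ᵐ[volume] tet T :=
  interior_ae_eq_of_null_frontier ((convex_tet T).addHaar_frontier volume)

/-- The open cell of the Alfeld split opposite the vertex `i`. -/
def openCell (T : Affine.Simplex ℝ E3 3) (z : E3) (i : Fin 4) : Set E3 :=
  interior (tet T) ∩ openSec T z i

theorem isOpen_openCell (T : Affine.Simplex ℝ E3 3) (z : E3) (i : Fin 4) :
    IsOpen (openCell T z i) :=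
  isOpen_interior.inter (isOpen_openSec T z i)

theorem openCell_ae_eq {T : Affine.Simplex ℝ E3 3} {z : E3} (hz : z ∈ T.interior) (i : Fin 4) :
    openCell T z i =ᵐ[volume] alfeldTet T z i := by
  rw [alfeldTet_eq hz]
  exact (interior_tet_ae_eq T).inter (openSec_ae_eq_sec hz i)

theorem facePoint_mem_sec {T : Affine.Simplex ℝ E3 3} {z : E3} (hz : z ∈ T.interior)
    {i j : Fin 4} (h : i ≠ j) {η : Fin 2 → ℝ} (hη : η ∈ Set.Ici (0 : Fin 2 → ℝ)) :
    facePoint T z i j η ∈ sec T z i := by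
  obtain ⟨m, rfl⟩ := Fin.exists_succAbove_eq h.symm
  rw [← secParam_insertNth, ← Set.mem_preimage, secParam_preimage_sec hz, Set.mem_Ici]
  intro k
  rcases Fin.eq_self_or_eq_succAbove m k with rfl | ⟨n, rfl⟩
  · simp
  · simpa using hη n

theorem openCell_nonempty {T : Affine.Simplex ℝ E3 3} {z : E3} (hz : z ∈ T.interior) (i : Fin 4) :
    (openCell T z i).Nonempty := by
  have hpos := lam_pos_of_mem_interior hz
  -- Three coordinates equal to 1/4 are positive and sum to less than one.
  refine ⟨secParam T z i fun _ => 1 / 4, ?_, ?_⟩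
  · rw [interior_tet]
    intro j
    rcases Fin.eq_self_or_eq_succAbove i j with rfl | ⟨n, rfl⟩
    · rw [lam_secParam_self]
      have := hpos j
      norm_num; linarith
    · rw [lam_secParam_succAbove]
      have := hpos (i.succAbove n)
      norm_num; linarith
  · intro j hj
    obtain ⟨n, rfl⟩ := Fin.exists_succAbove_eq hj
    rw [lam_secParam_self, lam_secParam_succAbove]
    have := hpos i
    nlinarith

theorem tet_eq_iUnion {T : Affine.Simplex ℝ E3 3} {z : E3} (hz : z ∈ T.interior) :
    tet T = ⋃ i, alfeldTet T z i := by
  have hpos := lam_pos_of_mem_interior hz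
  refine Set.Subset.antisymm (fun y hy => ?_)
    (Set.iUnion_subset (alfeldTet_subset (T.interior_subset_closedInterior hz)))
  -- A point lies in the cone at which the ratio $\lambda_j(y)/\lambda_j(z)$ is smallest.
  obtain ⟨i, hi⟩ := Finite.exists_min fun j => lam T j y / lam T j z
  refine Set.mem_iUnion.2 ⟨i, (mem_alfeldTet_iff hz i y).2 ⟨hy, fun j => ?_⟩⟩
  exact (div_le_div_iff₀ (hpos i) (hpos j)).1 (hi j)

theorem aedisjoint_alfeldTet {T : Affine.Simplex ℝ E3 3} {z : E3} (hz : z ∈ T.interior) :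
    Pairwise (Function.onFun (AEDisjoint volume) (alfeldTet T z)) := by
  intro i j h
  refine measure_mono_null (fun y hy => ?_) (volume_splitting_plane hz h)
  simp only [alfeldTet_eq hz] at hy
  exact le_antisymm (hy.2.2 i) (hy.1.2 j)

theorem measurableSet_alfeldTet (T : Affine.Simplex ℝ E3 3) (z : E3) (i : Fin 4) :
    MeasurableSet (alfeldTet T z i) :=
  (isCompact_alfeldTet T z i).measurableSet

theorem ae_tet_of_forall_alfeldTet {T : Affine.Simplex ℝ E3 3} {z : E3} (hz : z ∈ T.interior)
    {P : E3 → Prop} (h : ∀ i, ∀ᵐ x ∂volume.restrict (alfeldTet T z i), P x) :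
    ∀ᵐ x ∂volume.restrict (tet T), P x := by
  rw [tet_eq_iUnion hz, ae_restrict_iUnion_iff]
  exact h

theorem integrableOn_tet {T : Affine.Simplex ℝ E3 3} {z : E3} (hz : z ∈ T.interior) {f : E3 → ℝ}
    (h : ∀ i, IntegrableOn f (alfeldTet T z i)) : IntegrableOn f (tet T) := by
  rw [tet_eq_iUnion hz, integrableOn_finite_iUnion]
  exact h

theorem setIntegral_tet {T : Affine.Simplex ℝ E3 3} {z : E3} (hz : z ∈ T.interior) {f : E3 → ℝ}
    (h : ∀ i, IntegrableOn f (alfeldTet T z i)) :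
    ∫ x in tet T, f x = ∑ i, ∫ x in alfeldTet T z i, f x := by
  have h1 := integrableOn_tet hz h
  rw [tet_eq_iUnion hz] at h1 ⊢
  rw [integral_iUnion_ae (fun i => (measurableSet_alfeldTet T z i).nullMeasurableSet)
    (aedisjoint_alfeldTet hz) h1, tsum_fintype]

theorem setIntegral_alfeldTet_eq_sec {T : Affine.Simplex ℝ E3 3} {z : E3} (hz : z ∈ T.interior)
    (i : Fin 4) {f : E3 → ℝ} (h : ∀ x, x ∉ tet T → f x = 0) :
    ∫ x in alfeldTet T z i, f x = ∫ x in sec T z i, f x := by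
  rw [alfeldTet_eq hz]
  refine (setIntegral_eq_of_subset_of_forall_sdiff_eq_zero (isClosed_sec T z i).measurableSet
    Set.inter_subset_right fun x hx => h x fun hx' => hx.2 ⟨hx', hx.1⟩).symm

/-! ### Integration by parts for piecewise affine matrix fields. -/

/-- The entry of a matrix-valued affine map. -/
def entry (p : E3 →ᵃ[ℝ] SymMat) (r c : Fin 3) : E3 →ᵃ[ℝ] ℝ :=
  ((Matrix.entryLinearMap ℝ ℝ r c).comp SymMat.subtype).toAffineMap.comp p

theorem entry_apply (p : E3 →ᵃ[ℝ] SymMat) (r c : Fin 3) (y : E3) :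
    entry p r c y = (p y).1 r c := rfl

/-- The divergence of the row `r` of a matrix-valued affine map. -/
def affDiv (p : E3 →ᵃ[ℝ] SymMat) (r : Fin 3) : ℝ :=
  ∑ c, (entry p r c).linear (EuclideanSpace.single c 1)

/-- The vector that represents a linear functional. -/
def toVec (N : E3 →ₗ[ℝ] ℝ) (c : Fin 3) : ℝ := N (EuclideanSpace.single c 1)

theorem AffineMap.hasFDerivAt_of_finiteDimensional (e : E3 →ᵃ[ℝ] ℝ) (y : E3) :
    HasFDerivAt e (LinearMap.toContinuousLinearMap e.linear) y := by
  have h : (e : E3 → ℝ) = fun y => LinearMap.toContinuousLinearMap e.linear y + e 0 := by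
    funext y
    exact congrFun (AffineMap.decomp e) y
  rw [h]
  exact (LinearMap.toContinuousLinearMap e.linear).hasFDerivAt.add_const _

theorem AffineMap.contDiff_of_finiteDimensional (e : E3 →ᵃ[ℝ] ℝ) {n : WithTop ℕ∞} :
    ContDiff ℝ n e := by
  have h : (e : E3 → ℝ) = fun y => LinearMap.toContinuousLinearMap e.linear y + e 0 := by
    funext y
    exact congrFun (AffineMap.decomp e) y
  rw [h]
  exact (LinearMap.toContinuousLinearMap e.linear).contDiff.add contDiff_const

/-- The flux of `p φ`, in the row `r`, through the common face of two cones. -/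
def faceFlux (T : Affine.Simplex ℝ E3 3) (z : E3) (p : E3 →ᵃ[ℝ] SymMat) (φ : E3 → ℝ)
    (r : Fin 3) (i j : Fin 4) : ℝ :=
  ∫ η in Set.Ici (0 : Fin 2 → ℝ), ((p (facePoint T z i j η)).1 *ᵥ toVec (faceNormal T z i j)) r *
    φ (facePoint T z i j η)

/-- The divergence theorem on the cone is applied to the product of each entry with $\varphi$; the
derivative of the affine entry is constant and leaves the factor `affDiv p r`. -/
theorem setIntegral_sec_row_fderiv {T : Affine.Simplex ℝ E3 3} {z : E3} (hz : z ∈ T.interior)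
    (i : Fin 4) (p : E3 →ᵃ[ℝ] SymMat) {φ : E3 → ℝ} (hφ : ContDiff ℝ 1 φ)
    (hc : HasCompactSupport φ) (r : Fin 3) :
    ∫ y in sec T z i, ∑ c, (p y).1 r c * fderiv ℝ φ y (EuclideanSpace.single c 1) =
      -(affDiv p r * ∫ y in sec T z i, φ y) -
        volFactor T z * ∑ j, faceFlux T z p φ r i j := by
  have hφc := hφ.continuous
  have hφ' : Continuous (fderiv ℝ φ) := hφ.continuous_fderiv one_ne_zero
  have hφd (y : E3) : HasFDerivAt φ (fderiv ℝ φ y) y :=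
    (hφ.differentiable one_ne_zero y).hasFDerivAt
  have hcont (c : Fin 3) : ContDiff ℝ 1 (entry p r c) :=
    AffineMap.contDiff_of_finiteDimensional _
  have hprod (c : Fin 3) (y : E3) : fderiv ℝ (fun y => entry p r c y * φ y) y
      (EuclideanSpace.single c 1) = entry p r c y * fderiv ℝ φ y (EuclideanSpace.single c 1) +
        (entry p r c).linear (EuclideanSpace.single c 1) * φ y := by
    rw [((AffineMap.hasFDerivAt_of_finiteDimensional (entry p r c) y).fun_mul (hφd y)).fderiv]
    simp [mul_comm (φ y)]
  have hsupp (c : Fin 3) : HasCompactSupport fun y => entry p r c y * φ y := hc.mul_left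
  have hg (c : Fin 3) := setIntegral_sec_fderiv hz i (θ := fun y => entry p r c y * φ y) ((hcont c).mul hφ) (hsupp c)
    (EuclideanSpace.single c 1)
  have hint (c : Fin 3) : Integrable
      (fun y => entry p r c y * fderiv ℝ φ y (EuclideanSpace.single c 1))
        (volume.restrict (sec T z i)) :=
    (((hcont c).continuous.mul (hφ'.clm_apply continuous_const)).integrable_of_hasCompactSupport
      (hc.fderiv_apply ℝ _).mul_left).restrict
  have hint2 (c : Fin 3) : Integrable
      (fun y => (entry p r c).linear (EuclideanSpace.single c 1) * φ y)
        (volume.restrict (sec T z i)) :=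
    ((continuous_const.mul hφc).integrable_of_hasCompactSupport hc.mul_left).restrict
  simp only [hprod] at hg
  have hflux (m : Fin 3) : faceFlux T z p φ r i (i.succAbove m) =
      ∑ c, faceNormal T z i (i.succAbove m) (EuclideanSpace.single c 1) *
        ∫ η in Set.Ici (0 : Fin 2 → ℝ), entry p r c (facePoint T z i (i.succAbove m) η) *
          φ (facePoint T z i (i.succAbove m) η) := by
    simp only [← integral_const_mul]
    rw [← integral_finsetSum]
    · refine integral_congr_ae (Filter.Eventually.of_forall fun η => ?_)
      simp only [Matrix.mulVec, dotProduct, Finset.sum_mul, toVec, entry_apply]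
      exact Finset.sum_congr rfl fun c _ => by ring
    · intro c _
      refine Integrable.const_mul ?_ _
      refine (Continuous.integrable_of_hasCompactSupport ?_ ?_).restrict
      · exact ((hcont c).continuous.mul hφc).comp (facePoint_continuous T z _ _)
      · exact (hsupp c).comp_isClosedEmbedding
          (isClosedEmbedding_facePoint hz (Fin.succAbove_ne i m).symm)
  have h0 : faceFlux T z p φ r i i = 0 := by
    have : toVec (faceNormal T z i i) = 0 := by
      funext c; simp [toVec, faceNormal_self]
    simp [faceFlux, this]
  rw [Fin.sum_univ_succAbove _ i, h0, zero_add]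
  simp only [hflux]
  simp only [← entry_apply]
  rw [integral_finsetSum _ fun c _ => hint c, affDiv, Finset.sum_mul, Finset.sum_comm,
    Finset.mul_sum, ← Finset.sum_neg_distrib, ← Finset.sum_sub_distrib]
  refine Finset.sum_congr rfl fun c _ => ?_
  have := hg c
  rw [integral_add (hint c) (hint2 c), integral_const_mul] at this
  linarith

theorem eq_zero_of_notMem_tet {T : Affine.Simplex ℝ E3 3} {f : E3 → ℝ}
    (h : tsupport f ⊆ interior (tet T)) {x : E3} (hx : x ∉ tet T) : f x = 0 :=
  image_eq_zero_of_notMem_tsupport fun h' => hx (interior_subset (h h'))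

theorem setIntegral_tet_row_fderiv {T : Affine.Simplex ℝ E3 3} {z : E3} (hz : z ∈ T.interior)
    {ω : E3 → SymMat} {p : Fin 4 → E3 →ᵃ[ℝ] SymMat} (hp : ∀ i, IsPiece T z ω i (p i))
    {φ : E3 → ℝ} (hφ : ContDiff ℝ 1 φ) (hc : HasCompactSupport φ)
    (hs : tsupport φ ⊆ interior (tet T)) (r : Fin 3) :
    ∫ x in tet T, ∑ c, (ω x).1 r c * fderiv ℝ φ x (EuclideanSpace.single c 1) =
      -(∑ i, affDiv (p i) r * ∫ x in alfeldTet T z i, φ x) -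
        volFactor T z * ∑ i, ∑ j, faceFlux T z (p i) φ r i j := by
  have hφ' : Continuous (fderiv ℝ φ) := hφ.continuous_fderiv one_ne_zero
  have hae (i : Fin 4) : ∀ᵐ x ∂volume.restrict (alfeldTet T z i),
      ∑ c, (ω x).1 r c * fderiv ℝ φ x (EuclideanSpace.single c 1) =
        ∑ c, (p i x).1 r c * fderiv ℝ φ x (EuclideanSpace.single c 1) := by
    filter_upwards [hp i] with x hx
    rw [hx]
  have hcont (i : Fin 4) : Continuous fun x =>
      ∑ c, (p i x).1 r c * fderiv ℝ φ x (EuclideanSpace.single c 1) :=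
    continuous_finsetSum _ fun c _ =>
      (AffineMap.contDiff_of_finiteDimensional (entry (p i) r c) (n := 0)).continuous.mul
        (hφ'.clm_apply continuous_const)
  rw [setIntegral_tet hz fun i =>
    ((hcont i).continuousOn.integrableOn_compact (isCompact_alfeldTet T z i)).congr_fun_ae
      (Filter.EventuallyEq.symm (hae i)), ← Finset.sum_neg_distrib, Finset.mul_sum,
    ← Finset.sum_sub_distrib]
  refine Finset.sum_congr rfl fun i _ => ?_
  rw [integral_congr_ae (hae i), setIntegral_alfeldTet_eq_sec hz, setIntegral_alfeldTet_eq_sec hz,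
    setIntegral_sec_row_fderiv hz i (p i) hφ hc r]
  · exact fun x hx => eq_zero_of_notMem_tet hs hx
  · intro x hx
    have : fderiv ℝ φ x = 0 :=
      fderiv_of_notMem_tsupport ℝ fun h' => hx (interior_subset (hs h'))
    simp [this]

/-! ### Normal continuity implies membership in H(div). -/

/-- Continuity of the normal components of a piecewise affine matrix field across the common faces
of the cells. -/
def JumpFree (T : Affine.Simplex ℝ E3 3) (z : E3) (p : Fin 4 → E3 →ᵃ[ℝ] SymMat) : Prop :=
  ∀ i j, i ≠ j → ∀ η, (p i (facePoint T z i j η)).1 *ᵥ toVec (faceNormal T z i j) =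
    (p j (facePoint T z i j η)).1 *ᵥ toVec (faceNormal T z i j)

theorem toVec_faceNormal_swap (T : Affine.Simplex ℝ E3 3) (z : E3) (i j : Fin 4) :
    toVec (faceNormal T z j i) = -toVec (faceNormal T z i j) :=
  funext fun _ => faceNormal_swap T z i j _

theorem faceFlux_self (T : Affine.Simplex ℝ E3 3) (z : E3) (p : E3 →ᵃ[ℝ] SymMat) (φ : E3 → ℝ)
    (r : Fin 3) (i : Fin 4) : faceFlux T z p φ r i i = 0 := by
  have : toVec (faceNormal T z i i) = 0 := by
    funext c; simp [toVec, faceNormal_self]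
  simp [faceFlux, this]

/-- The two cells at a face share its parametrization and have opposite normals, so without jumps
the flux is antisymmetric in the pair of cells. -/
theorem sum_faceFlux_eq_zero {T : Affine.Simplex ℝ E3 3} {z : E3}
    {p : Fin 4 → E3 →ᵃ[ℝ] SymMat} (hp : JumpFree T z p) (φ : E3 → ℝ) (r : Fin 3) :
    ∑ i, ∑ j, faceFlux T z (p i) φ r i j = 0 := by
  have hanti (i j : Fin 4) : faceFlux T z (p j) φ r j i = -faceFlux T z (p i) φ r i j := by
    by_cases h : i = j
    · subst h; simp [faceFlux_self]
    · rw [faceFlux, faceFlux, ← integral_neg]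
      congr 1
      funext η
      rw [toVec_faceNormal_swap T z i j, ← facePoint_comm T z h, Matrix.mulVec_neg, Pi.neg_apply,
        ← hp i j h, neg_mul]
  have h1 : ∑ i, ∑ j, faceFlux T z (p i) φ r i j = -∑ i, ∑ j, faceFlux T z (p i) φ r i j := by
    conv_lhs => rw [Finset.sum_comm]
    simp only [← Finset.sum_neg_distrib, ← hanti]
  linarith

open Classical in
/-- The field equal to `f i` on the `i`-th open cone, and zero elsewhere. -/
def glue (T : Affine.Simplex ℝ E3 3) (z : E3) {V : Type*} [AddCommGroup V] (f : Fin 4 → E3 → V)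
    (x : E3) : V :=
  ∑ i, if x ∈ openSec T z i then f i x else 0

theorem glue_apply (T : Affine.Simplex ℝ E3 3) (z : E3) {V : Type*} [AddCommGroup V]
    (f : Fin 4 → E3 → V) {x : E3} {i : Fin 4} (hx : x ∈ openSec T z i) : glue T z f x = f i x := by
  rw [glue, Finset.sum_eq_single i, if_pos hx]
  · intro j _ hj
    exact if_neg fun hx' => Set.disjoint_left.1 (disjoint_openSec T z hj) hx' hx
  · simp

theorem ae_alfeldTet_mem_openCell {T : Affine.Simplex ℝ E3 3} {z : E3} (hz : z ∈ T.interior)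
    (i : Fin 4) : ∀ᵐ x ∂volume.restrict (alfeldTet T z i), x ∈ openCell T z i := by
  rw [← Measure.restrict_congr_set (openCell_ae_eq hz i)]
  exact ae_restrict_mem (isOpen_openCell T z i).measurableSet

theorem glue_ae_eq {T : Affine.Simplex ℝ E3 3} {z : E3} (hz : z ∈ T.interior) {V : Type*}
    [AddCommGroup V] (f : Fin 4 → E3 → V) (i : Fin 4) :
    ∀ᵐ x ∂volume.restrict (alfeldTet T z i), glue T z f x = f i x := by
  filter_upwards [ae_alfeldTet_mem_openCell hz i] with x hx
  exact glue_apply T z f hx.2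

theorem setIntegral_tet_div {T : Affine.Simplex ℝ E3 3} {z : E3} (hz : z ∈ T.interior)
    {g : E3 → ℝ} {d : Fin 4 → ℝ} (hg : ∀ i, ∀ᵐ x ∂volume.restrict (alfeldTet T z i), g x = d i)
    {φ : E3 → ℝ} (hφ : Continuous φ) :
    ∫ x in tet T, g x * φ x = ∑ i, d i * ∫ x in alfeldTet T z i, φ x := by
  have hae (i : Fin 4) : ∀ᵐ x ∂volume.restrict (alfeldTet T z i), g x * φ x = d i * φ x := by
    filter_upwards [hg i] with x hx
    rw [hx]
  rw [setIntegral_tet hz fun i =>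
    ((continuous_const.mul hφ).continuousOn.integrableOn_compact
      (isCompact_alfeldTet T z i)).congr_fun_ae (Filter.EventuallyEq.symm (hae i))]
  refine Finset.sum_congr rfl fun i _ => ?_
  rw [integral_congr_ae (hae i), integral_const_mul]

theorem isWeakDiv_of_jumpFree {T : Affine.Simplex ℝ E3 3} {z : E3} (hz : z ∈ T.interior)
    {ω : E3 → SymMat} {p : Fin 4 → E3 →ᵃ[ℝ] SymMat} (hp : ∀ i, IsPiece T z ω i (p i))
    (hj : JumpFree T z p) :
    IsWeakDiv (tet T) ω (glue T z fun i _ => affDiv (p i)) := by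
  intro φ h1 h2 h3 r
  rw [setIntegral_tet_row_fderiv hz hp (h1.of_le (by exact_mod_cast le_top)) h2 h3,
    sum_faceFlux_eq_zero hj, mul_zero, sub_zero,
    setIntegral_tet_div hz (d := fun i => affDiv (p i) r) ?_ h1.continuous]
  intro i
  filter_upwards [glue_ae_eq hz (fun i _ => affDiv (p i)) i] with x hx
  rw [hx]

theorem memLp_tet_of_pieces {T : Affine.Simplex ℝ E3 3} {z : E3} (hz : z ∈ T.interior)
    {g : E3 → ℝ} {f : Fin 4 → E3 → ℝ} (hf : ∀ i, Continuous (f i))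
    (hg : ∀ i, ∀ᵐ x ∂volume.restrict (alfeldTet T z i), g x = f i x) :
    MemLp g 2 (volume.restrict (tet T)) := by
  have hfin : IsFiniteMeasure (volume.restrict (tet T)) :=
    ⟨by simpa using (isCompact_tet T).measure_lt_top⟩
  have hb (i : Fin 4) : ∃ C, ∀ x ∈ alfeldTet T z i, ‖f i x‖ ≤ C :=
    (isCompact_alfeldTet T z i).exists_bound_of_continuousOn (hf i).continuousOn
  choose C hC using hb
  refine MemLp.of_bound ?_ (∑ i, |C i|) (ae_tet_of_forall_alfeldTet hz fun i => ?_)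
  · rw [tet_eq_iUnion hz, aestronglyMeasurable_iUnion_iff]
    exact fun i => ((hf i).aestronglyMeasurable).congr (Filter.EventuallyEq.symm (hg i))
  · filter_upwards [hg i, ae_restrict_mem (measurableSet_alfeldTet T z i)] with x h1 h2
    rw [h1]
    exact ((hC i x h2).trans (le_abs_self _)).trans
      (Finset.single_le_sum (f := fun i => |C i|) (fun _ _ => abs_nonneg _) (Finset.mem_univ i))

theorem isL2Mat_of_pieces {T : Affine.Simplex ℝ E3 3} {z : E3} (hz : z ∈ T.interior)
    {ω : E3 → SymMat} {p : Fin 4 → E3 →ᵃ[ℝ] SymMat} (hp : ∀ i, IsPiece T z ω i (p i)) :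
    IsL2Mat (tet T) ω := by
  intro r c
  refine memLp_tet_of_pieces hz (f := fun i => entry (p i) r c) (fun i =>
    (AffineMap.contDiff_of_finiteDimensional (entry (p i) r c) (n := 0)).continuous) fun i => ?_
  filter_upwards [hp i] with x hx
  rw [hx]; rfl

theorem isL2Vec_glue {T : Affine.Simplex ℝ E3 3} {z : E3} (hz : z ∈ T.interior)
    (d : Fin 4 → Fin 3 → ℝ) : IsL2Vec (tet T) (glue T z fun i _ => d i) := by
  intro r
  refine memLp_tet_of_pieces hz (f := fun i _ => d i r) (fun i => continuous_const) fun i => ?_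
  filter_upwards [glue_ae_eq hz (fun i _ => d i) i] with x hx
  rw [hx]

/-! ### Membership in H(div) implies normal continuity. -/

theorem facePoint_mem_sec_right {T : Affine.Simplex ℝ E3 3} {z : E3} (hz : z ∈ T.interior)
    {i j : Fin 4} (h : i ≠ j) {η : Fin 2 → ℝ} (hη : η ∈ Set.Ici (0 : Fin 2 → ℝ)) :
    facePoint T z i j η ∈ sec T z j := by
  rw [facePoint_comm T z h]
  exact facePoint_mem_sec hz h.symm hη

theorem faceFlux_eq_zero_of_forall {T : Affine.Simplex ℝ E3 3} {z : E3} (p : E3 →ᵃ[ℝ] SymMat)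
    {φ : E3 → ℝ} (r : Fin 3) {i j : Fin 4}
    (h : ∀ η ∈ Set.Ici (0 : Fin 2 → ℝ), facePoint T z i j η ∉ tsupport φ) :
    faceFlux T z p φ r i j = 0 := by
  refine setIntegral_eq_zero_of_forall_eq_zero fun η hη => ?_
  rw [image_eq_zero_of_notMem_tsupport (h η hη), mul_zero]

/-- A test function supported in one open cell meets no interior face, so every flux vanishes and
the fundamental lemma of the calculus of variations identifies `g` there. -/
theorem weakDiv_ae_eq {T : Affine.Simplex ℝ E3 3} {z : E3} (hz : z ∈ T.interior)
    {ω : E3 → SymMat} {p : Fin 4 → E3 →ᵃ[ℝ] SymMat} (hp : ∀ i, IsPiece T z ω i (p i))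
    {g : E3 → Fin 3 → ℝ} (hg : IsL2Vec (tet T) g) (hw : IsWeakDiv (tet T) ω g) (r : Fin 3)
    (i : Fin 4) : ∀ᵐ x ∂volume.restrict (alfeldTet T z i), g x r = affDiv (p i) r := by
  have hfin : IsFiniteMeasure (volume.restrict (tet T)) :=
    ⟨by simpa using (isCompact_tet T).measure_lt_top⟩
  have hcell : openCell T z i ⊆ tet T := fun x hx => interior_subset hx.1
  have hgi : IntegrableOn (fun x => g x r) (tet T) := (hg r).integrable (by norm_num)
  have hloc : LocallyIntegrableOn (fun x => g x r - affDiv (p i) r) (openCell T z i) volume :=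
    ((hgi.sub (integrable_const _)).mono_set hcell).locallyIntegrableOn
  have key := (isOpen_openCell T z i).ae_eq_zero_of_integral_contDiff_smul_eq_zero hloc ?_
  · filter_upwards [ae_restrict_of_ae key, ae_alfeldTet_mem_openCell hz i] with x h1 h2
    exact sub_eq_zero.1 (h1 h2)
  intro φ h1 h2 h3
  have h4 : tsupport φ ⊆ interior (tet T) := fun x hx => (h3 hx).1
  have e1 := hw φ h1 h2 h4 r
  have e2 : ∑ i, ∑ j, faceFlux T z (p i) φ r i j = 0 := by
    refine Finset.sum_eq_zero fun k _ => Finset.sum_eq_zero fun l _ => ?_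
    by_cases hkl : k = l
    · subst hkl; exact faceFlux_self T z _ _ _ _
    refine faceFlux_eq_zero_of_forall _ _ fun η hη hη' => ?_
    have h5 := (h3 hη').2
    by_cases hk : i = k
    · exact Set.disjoint_left.1 (disjoint_openSec_sec T z (hk ▸ hkl)) h5
        (facePoint_mem_sec_right hz hkl hη)
    · exact Set.disjoint_left.1 (disjoint_openSec_sec T z hk) h5 (facePoint_mem_sec hz hkl hη)
  have e3 : ∑ k, affDiv (p k) r * ∫ x in alfeldTet T z k, φ x =
      affDiv (p i) r * ∫ x in tet T, φ x := by
    have h5 (k : Fin 4) (hk : k ≠ i) : ∫ x in alfeldTet T z k, φ x = 0 := by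
      refine setIntegral_eq_zero_of_forall_eq_zero fun x hx => ?_
      refine image_eq_zero_of_notMem_tsupport fun hx' => ?_
      exact Set.disjoint_left.1 (disjoint_openSec_sec T z hk.symm) (h3 hx').2
        ((mem_alfeldTet_iff hz k x).1 hx).2
    rw [setIntegral_tet hz fun i =>
      h1.continuous.continuousOn.integrableOn_compact (isCompact_alfeldTet T z i),
      Finset.sum_eq_single i (fun k _ hk => by rw [h5 k hk, mul_zero]) (by simp),
      Finset.sum_eq_single i (fun k _ hk => by rw [h5 k hk]) (by simp)]
  rw [setIntegral_tet_row_fderiv hz hp (h1.of_le (by exact_mod_cast le_top)) h2 h4, e2, e3,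
    mul_zero, sub_zero, neg_inj] at e1
  have hφi : IntegrableOn φ (tet T) := h1.continuous.continuousOn.integrableOn_compact (isCompact_tet T)
  have e4 : ∫ x, φ x • (g x r - affDiv (p i) r) =
      ∫ x in tet T, (g x r * φ x - affDiv (p i) r * φ x) := by
    rw [← setIntegral_eq_integral_of_forall_compl_eq_zero (s := tet T)
      fun x hx => by rw [eq_zero_of_notMem_tet h4 hx, zero_smul]]
    congr 1
    funext x
    rw [smul_eq_mul]; ring
  rw [e4, integral_sub (integrable_mul_test (hg r) h1.continuous h2) (hφi.const_mul _),
    integral_const_mul, e1, sub_self]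

theorem AffineMap.eq_of_eqOn_open {E V : Type*} [NormedAddCommGroup E] [NormedSpace ℝ E]
    [AddCommGroup V] [Module ℝ V] {U : Set E} (hU : IsOpen U) (hne : U.Nonempty)
    {f g : E →ᵃ[ℝ] V} (h : Set.EqOn f g U) : f = g :=
  AffineMap.ext_on (hU.affineSpan_eq_top hne) h

/-- Once `g` is known to be the cellwise divergence, the volume terms cancel for every test function
and only the fluxes remain. -/
theorem sum_faceFlux_eq_zero_of_isWeakDiv {T : Affine.Simplex ℝ E3 3} {z : E3}
    (hz : z ∈ T.interior) {ω : E3 → SymMat} {p : Fin 4 → E3 →ᵃ[ℝ] SymMat}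
    (hp : ∀ i, IsPiece T z ω i (p i)) {g : E3 → Fin 3 → ℝ} (hg : IsL2Vec (tet T) g)
    (hw : IsWeakDiv (tet T) ω g) (r : Fin 3) {φ : E3 → ℝ}
    (h1 : ContDiff ℝ ((⊤ : ℕ∞) : WithTop ℕ∞) φ) (h2 : HasCompactSupport φ)
    (h3 : tsupport φ ⊆ interior (tet T)) : ∑ i, ∑ j, faceFlux T z (p i) φ r i j = 0 := by
  have e1 := hw φ h1 h2 h3 r
  rw [setIntegral_tet_row_fderiv hz hp (h1.of_le (by exact_mod_cast le_top)) h2 h3,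
    setIntegral_tet_div hz (weakDiv_ae_eq hz hp hg hw r) h1.continuous] at e1
  have : volFactor T z * ∑ i, ∑ j, faceFlux T z (p i) φ r i j = 0 := by linarith
  exact (mul_eq_zero.1 this).resolve_left (volFactor_pos hz).ne'

/-- The points of the interior of `T` whose only neighbouring cells are the cells opposite the
vertices `i` and `j`. -/
def faceNhd (T : Affine.Simplex ℝ E3 3) (z : E3) (i j : Fin 4) : Set E3 :=
  interior (tet T) ∩ {y | ∀ k, k ≠ i → k ≠ j →
    lam T i y * lam T k z < lam T k y * lam T i z ∧ lam T j y * lam T k z < lam T k y * lam T j z}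

theorem isOpen_faceNhd (T : Affine.Simplex ℝ E3 3) (z : E3) (i j : Fin 4) :
    IsOpen (faceNhd T z i j) := by
  refine isOpen_interior.inter ?_
  simp only [Set.ofPred_forall]
  refine isOpen_iInter_of_finite fun k => isOpen_iInter_of_finite fun _ =>
    isOpen_iInter_of_finite fun _ => IsOpen.and (isOpen_lt ?_ ?_) (isOpen_lt ?_ ?_)
  all_goals exact (lam_continuous T _).mul continuous_const

theorem facePoint_mem_faceNhd {T : Affine.Simplex ℝ E3 3} {z : E3} (hz : z ∈ T.interior)
    {i j : Fin 4} (h : i ≠ j) {η : Fin 2 → ℝ} (h0 : ∀ n, 0 < η n) (h1 : ∑ n, η n < 1) :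
    facePoint T z i j η ∈ faceNhd T z i j := by
  have hpos := lam_pos_of_mem_interior hz
  have hs : 0 < 1 - ∑ n, η n := by linarith
  have hnn (k : Fin 4) : 0 ≤ ∑ n, if k = faceIdx i j n then η n else 0 :=
    Finset.sum_nonneg fun n _ => by split_ifs; exacts [(h0 n).le, le_rfl]
  have hi : lam T i (facePoint T z i j η) = lam T i z * (1 - ∑ n, η n) := by
    rw [facePoint, lam_add_sum]
    simp [fun n => (faceIdx_ne_left i j n h).symm]
  have hj : lam T j (facePoint T z i j η) = lam T j z * (1 - ∑ n, η n) := by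
    rw [facePoint, lam_add_sum]
    simp [fun n => (faceIdx_ne_right i j n h).symm]
  refine ⟨?_, fun k hki hkj => ?_⟩
  · rw [interior_tet]
    intro k
    rw [facePoint, lam_add_sum]
    exact add_pos_of_pos_of_nonneg (mul_pos (hpos k) hs) (hnn k)
  · have hk : lam T k z * (1 - ∑ n, η n) < lam T k (facePoint T z i j η) := by
      rw [facePoint, lam_add_sum, lt_add_iff_pos_right]
      obtain ⟨n, hn⟩ := ((eq_or_eq_faceIdx i j k h).resolve_left hki).resolve_left hkj
      refine Finset.sum_pos' (fun n _ => by split_ifs; exacts [(h0 n).le, le_rfl])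
        ⟨n, Finset.mem_univ _, by rw [if_pos hn]; exact h0 n⟩
    rw [hi, hj]
    constructor <;> nlinarith [mul_lt_mul_of_pos_right hk (hpos i), mul_lt_mul_of_pos_right hk (hpos j)]

theorem faceFlux_eq_zero_of_tsupport_subset {T : Affine.Simplex ℝ E3 3} {z : E3}
    (hz : z ∈ T.interior) (p : E3 →ᵃ[ℝ] SymMat) {φ : E3 → ℝ} (r : Fin 3) {i j k l : Fin 4}
    (h : tsupport φ ⊆ faceNhd T z i j) (hk : ¬(k = i ∧ l = j)) (hk' : ¬(k = j ∧ l = i)) :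
    faceFlux T z p φ r k l = 0 := by
  by_cases hkl : k = l
  · subst hkl; exact faceFlux_self T z _ _ _ _
  refine faceFlux_eq_zero_of_forall _ _ fun η hη hη' => ?_
  have hmem := (h hη').2
  have hk1 := facePoint_mem_sec hz hkl hη
  have hl1 := facePoint_mem_sec_right hz hkl hη
  -- A different face involves a third cell, and `faceNhd` excludes the closed cone of that cell.
  have hor : (k ≠ i ∧ k ≠ j) ∨ (l ≠ i ∧ l ≠ j) := by
    by_contra hcon
    grind
  rcases hor with h5 | h5
  · exact absurd (hk1 i) (not_le_of_gt (hmem k h5.1 h5.2).1)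
  · exact absurd (hl1 i) (not_le_of_gt (hmem l h5.1 h5.2).1)

/-- The parametrization of a face as an affine map. -/
def facePointAff (T : Affine.Simplex ℝ E3 3) (z : E3) (i j : Fin 4) : (Fin 2 → ℝ) →ᵃ[ℝ] E3 :=
  (∑ n, (LinearMap.proj n : (Fin 2 → ℝ) →ₗ[ℝ] ℝ).smulRight
    (T.points (faceIdx i j n) - z)).toAffineMap + AffineMap.const ℝ _ z

theorem facePointAff_apply (T : Affine.Simplex ℝ E3 3) (z : E3) (i j : Fin 4) (η : Fin 2 → ℝ) :
    facePointAff T z i j η = facePoint T z i j η := by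
  simp [facePointAff, facePoint, add_comm]

/-- The open unit triangle. -/
def openTriangle : Set (Fin 2 → ℝ) := {η | (∀ n, 0 < η n) ∧ ∑ n, η n < 1}

theorem isOpen_openTriangle : IsOpen openTriangle := by
  refine IsOpen.and ?_ (isOpen_lt (continuous_finsetSum _ fun n _ => continuous_apply n)
    continuous_const)
  simp only [Set.ofPred_forall]
  exact isOpen_iInter_of_finite fun n => isOpen_lt continuous_const (continuous_apply n)

theorem openTriangle_nonempty : openTriangle.Nonempty :=
  ⟨fun _ => 1 / 3, fun _ => by norm_num, by norm_num⟩

/-- Matrix-vector multiplication of an affine map, one component. -/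
def rowAff (p : E3 →ᵃ[ℝ] SymMat) (w : Fin 3 → ℝ) (r : Fin 3) : E3 →ᵃ[ℝ] ℝ :=
  ∑ c, w c • entry p r c

theorem rowAff_apply (p : E3 →ᵃ[ℝ] SymMat) (w : Fin 3 → ℝ) (r : Fin 3) (y : E3) :
    rowAff p w r y = ((p y).1 *ᵥ w) r := by
  simp [rowAff, Fin.sum_univ_three, entry_apply, Matrix.mulVec, dotProduct, mul_comm]

/-- If a jump were nonzero at a point of the open face, a bump function concentrated there would see
only that face and a jump of constant sign, so the total flux could not vanish. The jump is affine
along the face, hence vanishing on the open triangle extends to the whole plane. -/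
theorem jumpFree_of_isWeakDiv {T : Affine.Simplex ℝ E3 3} {z : E3}
    (hz : z ∈ T.interior) {ω : E3 → SymMat} {p : Fin 4 → E3 →ᵃ[ℝ] SymMat}
    (hp : ∀ i, IsPiece T z ω i (p i)) {g : E3 → Fin 3 → ℝ} (hg : IsL2Vec (tet T) g)
    (hw : IsWeakDiv (tet T) ω g) : JumpFree T z p := by
  intro i j hij
  set w := toVec (faceNormal T z i j) with hwdef
  suffices h : ∀ r, (rowAff (p i) w r).comp (facePointAff T z i j) =
      (rowAff (p j) w r).comp (facePointAff T z i j) by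
    intro η
    funext r
    have := congrArg (fun f : (Fin 2 → ℝ) →ᵃ[ℝ] ℝ => f η) (h r)
    simpa [facePointAff_apply, rowAff_apply] using this
  intro r
  refine AffineMap.eq_of_eqOn_open isOpen_openTriangle openTriangle_nonempty fun η₀ hη₀ => ?_
  simp only [AffineMap.coe_comp, Function.comp_apply, facePointAff_apply]
  set y₀ := facePoint T z i j η₀ with hy₀
  set α : E3 → ℝ := fun y => rowAff (p i) w r y - rowAff (p j) w r y with hα
  have hαc : Continuous α := (AffineMap.continuous_of_finiteDimensional _).sub
    (AffineMap.continuous_of_finiteDimensional _)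
  by_contra hne
  have hα0 : α y₀ ≠ 0 := sub_ne_zero.2 hne
  -- Multiplying by the value at `y₀` makes the integrand nonnegative whatever the sign of the jump.
  have hV : IsOpen (faceNhd T z i j ∩ {y | 0 < α y₀ * α y}) :=
    (isOpen_faceNhd T z i j).inter (isOpen_lt continuous_const (continuous_const.mul hαc))
  have hmem : y₀ ∈ faceNhd T z i j ∩ {y | 0 < α y₀ * α y} :=
    ⟨facePoint_mem_faceNhd hz hij hη₀.1 hη₀.2, mul_self_pos.2 hα0⟩
  obtain ⟨φ, hs, hc, hφ, hr, h1⟩ := exists_contDiff_tsupport_subset (n := ⊤) (hV.mem_nhds hmem)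
  have hsU : tsupport φ ⊆ faceNhd T z i j := hs.trans Set.inter_subset_left
  have hsum := sum_faceFlux_eq_zero_of_isWeakDiv hz hp hg hw r hφ hc
    (hsU.trans Set.inter_subset_left)
  rw [← Fintype.sum_prod_type' (f := fun k l => faceFlux T z (p k) φ r k l),
    Finset.sum_eq_add (i, j) (j, i) (by simp [hij]) (fun x _ hx => ?_) (by simp) (by simp)] at hsum
  swap
  · refine faceFlux_eq_zero_of_tsupport_subset hz _ r hsU (fun h => hx.1 ?_) fun h => hx.2 ?_
    · exact Prod.ext h.1 h.2
    · exact Prod.ext h.1 h.2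
  have hint (q : E3 →ᵃ[ℝ] SymMat) : Integrable (fun η => rowAff q w r (facePoint T z i j η) *
      φ (facePoint T z i j η)) (volume.restrict (Set.Ici (0 : Fin 2 → ℝ))) := by
    refine (Continuous.integrable_of_hasCompactSupport (f := fun η =>
      rowAff q w r (facePoint T z i j η) * φ (facePoint T z i j η)) ?_ ?_).restrict
    · exact ((AffineMap.continuous_of_finiteDimensional _).mul hφ.continuous).comp
        (facePoint_continuous T z i j)
    · exact (hc.comp_isClosedEmbedding (isClosedEmbedding_facePoint hz hij)).mul_left
  set F : (Fin 2 → ℝ) → ℝ := fun η => α y₀ * (α (facePoint T z i j η) * φ (facePoint T z i j η))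
    with hF
  have hFi : IntegrableOn F (Set.Ici 0) := by
    refine Integrable.const_mul ?_ _
    simp only [hα, sub_mul]
    exact (hint _).sub (hint _)
  have hF0 : ∫ η in Set.Ici (0 : Fin 2 → ℝ), F η = 0 := by
    simp only [hF, integral_const_mul]
    simp only [hα, sub_mul (rowAff (p i) w r (facePoint T z i j _))]
    rw [integral_sub (hint _) (hint _)]
    have e1 : faceFlux T z (p i) φ r i j = ∫ η in Set.Ici (0 : Fin 2 → ℝ),
        rowAff (p i) w r (facePoint T z i j η) * φ (facePoint T z i j η) := by
      simp only [rowAff_apply]; rfl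
    have e2 : faceFlux T z (p j) φ r j i = -∫ η in Set.Ici (0 : Fin 2 → ℝ),
        rowAff (p j) w r (facePoint T z i j η) * φ (facePoint T z i j η) := by
      rw [faceFlux, toVec_faceNormal_swap T z i j, ← facePoint_comm T z hij, ← integral_neg]
      simp only [rowAff_apply, Matrix.mulVec_neg, Pi.neg_apply, neg_mul]
      rfl
    simp only [e1, e2] at hsum
    rw [← sub_eq_add_neg] at hsum
    rw [hsum, mul_zero]
  have hFnn : 0 ≤ F := by
    intro η
    by_cases hη : facePoint T z i j η ∈ tsupport φ
    · have := (hs hη).2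
      simp only [hF, Pi.zero_apply, ← mul_assoc]
      exact mul_nonneg (le_of_lt this) (hr ⟨_, rfl⟩).1
    · simp [hF, image_eq_zero_of_notMem_tsupport hη]
  have hFc : Continuous F := continuous_const.mul ((hαc.mul hφ.continuous).comp
    (facePoint_continuous T z i j))
  have hFae : F =ᵐ[volume.restrict openTriangle] 0 := by
    refine ae_restrict_of_ae_restrict_of_subset (s := openTriangle) (t := Set.Ici 0)
      (fun η hη n => (hη.1 n).le) ?_
    exact (setIntegral_eq_zero_iff_of_nonneg_ae (Filter.Eventually.of_forall hFnn) hFi).1 hF0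
  have := Measure.eqOn_open_of_ae_eq hFae isOpen_openTriangle hFc.continuousOn
    continuousOn_const hη₀
  simp [hF, ← hy₀, h1, hα0] at this

/-! ### Gradients of the barycentric coordinates and outward normals. -/

theorem sum_linear_lam_smul (T : Affine.Simplex ℝ E3 3) (v : E3) :
    ∑ j, (lam T j).linear v • T.points j = v := by
  have h1 := sum_lam_smul T v
  have h0 := sum_lam_smul T 0
  have h2 (j : Fin 4) : (lam T j).linear v = lam T j v - lam T j 0 := by
    rw [eq_sub_iff_add_eq]
    exact (congrFun (AffineMap.decomp (lam T j)) v).symm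
  simp only [h2, sub_smul, Finset.sum_sub_distrib, h1, h0, sub_zero]

/-- The gradient of the barycentric coordinate at the vertex `j`. -/
def gradLam (T : Affine.Simplex ℝ E3 3) (j : Fin 4) : Fin 3 → ℝ := toVec (lam T j).linear

theorem sum_gradLam (T : Affine.Simplex ℝ E3 3) : ∑ j, gradLam T j = 0 := by
  funext c
  rw [Finset.sum_apply]
  exact sum_lam_linear T _

theorem toVec_faceNormal (T : Affine.Simplex ℝ E3 3) (z : E3) (i j : Fin 4) :
    toVec (faceNormal T z i j) = lam T i z • gradLam T j - lam T j z • gradLam T i := rfl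

theorem sum_points_smul_gradLam (T : Affine.Simplex ℝ E3 3) (c : Fin 3) :
    ∑ j, T.points j c • gradLam T j = Pi.single c 1 := by
  funext c'
  have h := congrArg (fun v : E3 => v c) (sum_linear_lam_smul T (EuclideanSpace.single c' 1))
  simp only [WithLp.ofLp_sum, WithLp.ofLp_smul, Finset.sum_apply, Pi.smul_apply,
    smul_eq_mul, PiLp.ofLp_single] at h
  simp only [Finset.sum_apply, Pi.smul_apply, smul_eq_mul, gradLam, toVec, mul_comm (T.points _ c), h]
  simp [Pi.single_apply, eq_comm]

/-- Every edge from $x_i$ to another vertex has the height as its component along the normal, and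
$v=\sum_j(\nabla\lambda_j\cdot v)(x_j-x_i)$. The formula lets a vanishing normal trace be used as
$\omega\nabla\lambda_i=0$. -/
theorem outwardNormal_eq (T : Affine.Simplex ℝ E3 3) (i : Fin 4) :
    (outwardNormal T i).ofLp = -T.height i • gradLam T i := by
  have hh : T.height i = ‖T.altitudeFoot i - T.points i‖ := by
    rw [Affine.Simplex.height, dist_comm, dist_eq_norm]
  have hpos := T.height_pos i
  have key (v : E3) : inner ℝ (outwardNormal T i) v = -T.height i * (lam T i).linear v := by
    have e1 : ∑ j, (lam T j).linear v • (T.points j - T.points i) = v := by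
      simp only [smul_sub, Finset.sum_sub_distrib, sum_linear_lam_smul, ← Finset.sum_smul,
        sum_lam_linear, zero_smul, sub_zero]
    have e2 (j : Fin 4) (h : j ≠ i) :
        inner ℝ (outwardNormal T i) (T.points j - T.points i) = T.height i := by
      have h3 := T.inner_vsub_vsub_altitudeFoot_eq_height_sq h.symm
      rw [vsub_eq_sub, vsub_eq_sub, ← neg_sub (T.points j), ← neg_sub (T.altitudeFoot i), inner_neg_neg,
        real_inner_comm] at h3
      rw [outwardNormal, inner_smul_left, h3, ← hh]
      simp only [conj_trivial]
      field_simp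
    have e3 (j : Fin 4) : inner ℝ (outwardNormal T i) (T.points j - T.points i) =
        T.height i - if j = i then T.height i else 0 := by
      split_ifs with h
      · subst h; simp
      · rw [e2 j h, sub_zero]
    conv_lhs => rw [← e1, inner_sum]
    simp only [inner_smul_right, e3, mul_sub, Finset.sum_sub_distrib, ← Finset.sum_mul,
      sum_lam_linear]
    simp [mul_comm]
  funext c
  have := key (EuclideanSpace.single c 1)
  rw [EuclideanSpace.inner_single_right] at this
  simpa [gradLam, toVec] using this

/-! ### Linear algebra of the jump conditions at a point. -/

/-- Vanishing of the quadratic forms of matrices that satisfy the normal continuity conditions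
around a vertex of the split. -/
theorem quadraticForm_eq_zero {ι : Type*} {s : Set ι} {ζ : ι → ℝ} (hζ : ∀ i, 0 < ζ i)
    {b : ι → ι → ι → ℝ} (hsymm : ∀ i j l, b i j l = b i l j) (h0 : ∀ i ∈ s, ∀ l, b i i l = 0)
    (hj : ∀ i ∈ s, ∀ j ∈ s, i ≠ j → ∀ l, ζ i * b i j l = -(ζ j * b j i l)) :
    ∀ i ∈ s, ∀ j ∈ s, ∀ l ∈ s, b i j l = 0 := by
  intro i hi j hj' l hl
  have hne (i : ι) := (hζ i).ne'
  by_cases hij : i = j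
  · subst hij; exact h0 i hi l
  by_cases hil : i = l
  · subst hil; rw [hsymm]; exact h0 i hi j
  have h1 := hj i hi j hj' hij l
  by_cases hjl : j = l
  · subst hjl
    rw [hsymm j, h0 j hj', mul_zero, neg_zero] at h1
    exact (mul_eq_zero.1 h1).resolve_left (hne i)
  -- The three exchanges `e1`, `e2`, `e3` go once around the indices and return to the same term by
  -- symmetry; an odd number of signs forces it to be zero.
  have e2 : ζ j * b j i l = -(ζ l * b l j i) := by
    have := hj j hj' l hl hjl i
    rwa [hsymm j l i] at this
  have e3 : ζ l * b l j i = -(ζ i * b i j l) := by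
    have := hj l hl i hi (Ne.symm hil) j
    rwa [hsymm l i j, hsymm i l j] at this
  have e1 : ζ i * b i j l = -(ζ j * b j i l) := hj i hi j hj' hij l
  have : ζ i * b i j l = 0 := by linarith
  exact (mul_eq_zero.1 this).resolve_left (hne i)

/-- Summing `hj` over `i` gives $a_{jj}=-\zeta_jS$ with $S=\sum_i a_{ii}$; summing again over `j`
gives $S=-S$. -/
theorem normalDerivative_eq_zero {ι : Type*} [Fintype ι] {ζ : ι → ℝ} (hζ : ∑ i, ζ i = 1)
    {a : ι → ι → ℝ} (h1 : ∀ i, ∑ j, a i j = 0) (h2 : ∀ j, ∑ i, ζ i * a i j = 0)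
    (hj : ∀ i j, ζ i * a i j - ζ j * a i i = ζ i * a j j - ζ j * a j i) (i : ι) : a i i = 0 := by
  have h3 (j : ι) : a j j = -(ζ j * ∑ i, a i i) := by
    have := Finset.sum_congr (rfl : (Finset.univ : Finset ι) = _) fun i _ => hj i j
    simp only [Finset.sum_sub_distrib, ← Finset.mul_sum, ← Finset.sum_mul, h1, h2, hζ] at this
    linarith
  have h4 : ∑ i, a i i = -∑ i, a i i := by
    conv_lhs => rw [Finset.sum_congr rfl fun j _ => h3 j, Finset.sum_neg_distrib, ← Finset.sum_mul,
      hζ, one_mul]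
  have h5 : ∑ i, a i i = 0 := by linarith
  rw [h3, h5, mul_zero, neg_zero]

/-- The gradients span: each unit vector is a combination of them with vertex coordinates as
coefficients. -/
theorem eq_zero_of_form_eq_zero (T : Affine.Simplex ℝ E3 3) {M : Matrix (Fin 3) (Fin 3) ℝ}
    (h : ∀ j l, gradLam T l ⬝ᵥ M *ᵥ gradLam T j = 0) : M = 0 := by
  ext r c
  have e : Pi.single r 1 ⬝ᵥ M *ᵥ Pi.single c 1 = M r c := by simp
  rw [← e, ← sum_points_smul_gradLam T, ← sum_points_smul_gradLam T]
  simp only [Matrix.mulVec_sum, sum_dotProduct, dotProduct_sum, Matrix.mulVec_smul, smul_dotProduct,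
    dotProduct_smul, h]
  simp

theorem form_symm (T : Affine.Simplex ℝ E3 3) (M : SymMat) (j l : Fin 4) :
    gradLam T l ⬝ᵥ M.1 *ᵥ gradLam T j = gradLam T j ⬝ᵥ M.1 *ᵥ gradLam T l := by
  have hM : M.1ᵀ = M.1 := M.2
  rw [Matrix.dotProduct_mulVec, ← Matrix.mulVec_transpose, hM, dotProduct_comm]

/-- Symmetric matrices that satisfy the normal continuity conditions around a vertex of the split
vanish, if each annihilates the gradient of its barycentric coordinate. -/
theorem eq_zero_of_jump {T : Affine.Simplex ℝ E3 3} {z : E3} (hz : z ∈ T.interior) {s : Set (Fin 4)}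
    (hs : ∃ k, ∀ i, i ≠ k → i ∈ s) {M : Fin 4 → SymMat} (h0 : ∀ i ∈ s, (M i).1 *ᵥ gradLam T i = 0)
    (hj : ∀ i ∈ s, ∀ j ∈ s, i ≠ j →
      (M i).1 *ᵥ toVec (faceNormal T z i j) = (M j).1 *ᵥ toVec (faceNormal T z i j)) :
    ∀ i ∈ s, M i = 0 := by
  have key := quadraticForm_eq_zero (s := s) (lam_pos_of_mem_interior hz)
    (b := fun i j l => gradLam T l ⬝ᵥ (M i).1 *ᵥ gradLam T j) (fun i j l => form_symm T (M i) j l)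
    (fun i hi l => by simp [h0 i hi]) (fun i hi j hj' hij l => ?_)
  · intro i hi
    obtain ⟨k, hk⟩ := hs
    -- The gradients sum to zero, so the three indices other than `k` suffice to control the whole
    -- form.
    have hk' : gradLam T k = -∑ j ∈ {k}ᶜ, gradLam T j := by
      rw [eq_neg_iff_add_eq_zero, ← sum_gradLam T, ← Finset.sum_compl_add_sum {k}]
      simp [add_comm]
    have h1 (j l : Fin 4) (hl : l ∈ s) : gradLam T l ⬝ᵥ (M i).1 *ᵥ gradLam T j = 0 := by
      by_cases hjk : j = k
      · rw [hjk, hk', Matrix.mulVec_neg, dotProduct_neg, Matrix.mulVec_sum, dotProduct_sum,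
          Finset.sum_eq_zero, neg_zero]
        intro m hm
        exact key i hi m (hk m (by simpa using hm)) l hl
      · exact key i hi j (hk j hjk) l hl
    refine Subtype.ext (eq_zero_of_form_eq_zero T fun j l => ?_)
    by_cases hlk : l = k
    · rw [hlk, hk', neg_dotProduct, sum_dotProduct, Finset.sum_eq_zero, neg_zero]
      intro m hm
      exact h1 j m (hk m (by simpa using hm))
    · exact h1 j l (hk l hlk)
  · have h := congrArg (fun v => gradLam T l ⬝ᵥ v) (hj i hi j hj' hij)
    simp only [toVec_faceNormal, Matrix.mulVec_sub, Matrix.mulVec_smul, h0 i hi, h0 j hj',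
      dotProduct_smul, smul_eq_mul, smul_zero, sub_zero, zero_sub] at h
    simpa using h

/-! ### Normally continuous fields with vanishing normal trace. -/

theorem exists_facePoint_eq_points (T : Affine.Simplex ℝ E3 3) (z : E3) {i j k : Fin 4}
    (hij : i ≠ j) (hi : i ≠ k) (hj : j ≠ k) : ∃ η, facePoint T z i j η = T.points k := by
  obtain ⟨n, hn⟩ := ((eq_or_eq_faceIdx i j k hij).resolve_left hi.symm).resolve_left hj.symm
  exact ⟨Pi.single n 1, by simp [facePoint, hn, Pi.single_apply]⟩

theorem facePoint_zero (T : Affine.Simplex ℝ E3 3) (z : E3) (i j : Fin 4) :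
    facePoint T z i j 0 = z := by
  simp [facePoint]

theorem points_mem_facet (T : Affine.Simplex ℝ E3 3) {i k : Fin 4} (h : i ≠ k) :
    T.points k ∈ facet T i := by
  rw [mem_facet_iff]
  refine ⟨by simp [lam_points, h], fun j => ?_⟩
  rw [lam_points]; split_ifs <;> norm_num

/-- The three cells that contain $x_k$ share interior faces through it, and their outer facets also
contain it; so both the jump and the trace conditions can be evaluated at $x_k$. -/
theorem piece_points_eq_zero {T : Affine.Simplex ℝ E3 3} {z : E3} (hz : z ∈ T.interior)
    {p : Fin 4 → E3 →ᵃ[ℝ] SymMat} (hj : JumpFree T z p)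
    (h0 : ∀ i, ∀ x ∈ facet T i, (p i x).1 *ᵥ gradLam T i = 0) (i k : Fin 4) (h : i ≠ k) :
    p i (T.points k) = 0 := by
  refine eq_zero_of_jump hz (s := {k}ᶜ) ⟨k, fun i hi => hi⟩ (M := fun i => p i (T.points k))
    (fun i hi => h0 i _ (points_mem_facet T hi)) (fun i hi j hj' hij => ?_) i h
  obtain ⟨η, hη⟩ := exists_facePoint_eq_points T z hij hi hj'
  rw [← hη]
  exact hj i j hij η

theorem AffineMap.apply_eq_sum_lam {V : Type*} [AddCommGroup V] [Module ℝ V]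
    (T : Affine.Simplex ℝ E3 3) (f : E3 →ᵃ[ℝ] V) (y : E3) :
    f y = ∑ k, lam T k y • f (T.points k) := by
  conv_lhs => rw [← affineCombination_lam T y]
  rw [Finset.univ.map_affineCombination _ _ (sum_lam T y),
    Finset.univ.affineCombination_eq_linear_combination _ _ (sum_lam T y)]
  rfl

theorem piece_eq_lam_smul {T : Affine.Simplex ℝ E3 3} {z : E3} (hz : z ∈ T.interior)
    {p : Fin 4 → E3 →ᵃ[ℝ] SymMat} (hj : JumpFree T z p)
    (h0 : ∀ i, ∀ x ∈ facet T i, (p i x).1 *ᵥ gradLam T i = 0) (i : Fin 4) (y : E3) :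
    p i y = lam T i y • p i (T.points i) := by
  rw [AffineMap.apply_eq_sum_lam T, Finset.sum_eq_single i]
  · intro k _ hk
    rw [piece_points_eq_zero hz hj h0 i k hk.symm, smul_zero]
  · simp

theorem affDiv_eq {T : Affine.Simplex ℝ E3 3} {z : E3} (hz : z ∈ T.interior)
    {p : Fin 4 → E3 →ᵃ[ℝ] SymMat} (hj : JumpFree T z p)
    (h0 : ∀ i, ∀ x ∈ facet T i, (p i x).1 *ᵥ gradLam T i = 0) (i : Fin 4) :
    affDiv (p i) = (p i (T.points i)).1 *ᵥ gradLam T i := by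
  funext r
  simp only [affDiv, Matrix.mulVec, dotProduct]
  refine Finset.sum_congr rfl fun c _ => ?_
  have h : entry (p i) r c = (p i (T.points i)).1 r c • lam T i := by
    ext y
    rw [entry_apply, piece_eq_lam_smul hz hj h0]
    exact mul_comm _ _
  rw [h]
  rfl

/-- Since $p_i=\lambda_iA_i$, zero divergence says $A_i\nabla\lambda_i=0$. Thus the values at $z$
satisfy the same conditions as at a vertex, now with all four cells. -/
theorem eq_zero_of_affDiv_eq_zero {T : Affine.Simplex ℝ E3 3} {z : E3} (hz : z ∈ T.interior)
    {p : Fin 4 → E3 →ᵃ[ℝ] SymMat} (hj : JumpFree T z p)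
    (h0 : ∀ i, ∀ x ∈ facet T i, (p i x).1 *ᵥ gradLam T i = 0) (hd : ∀ i, affDiv (p i) = 0)
    (i : Fin 4) : p i = 0 := by
  have hz0 : p i z = 0 := by
    refine eq_zero_of_jump hz (s := Set.univ) ⟨0, fun _ _ => trivial⟩ (M := fun i => p i z)
      (fun i _ => ?_) (fun i _ j _ hij => ?_) i trivial
    · have := hd i
      rw [affDiv_eq hz hj h0] at this
      rw [piece_eq_lam_smul hz hj h0, Submodule.coe_smul, Matrix.smul_mulVec, this, smul_zero]
    · have := hj i j hij 0
      rwa [facePoint_zero] at this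
  rw [piece_eq_lam_smul hz hj h0] at hz0
  have := (smul_eq_zero.1 hz0).resolve_left (lam_pos_of_mem_interior hz i).ne'
  ext1 y
  rw [piece_eq_lam_smul hz hj h0, this, smul_zero]
  rfl

/-- `normalDerivative_eq_zero` is applied, row by row, to the vectors $p_i(z)\nabla\lambda_j$: they
sum to zero over $j$ because the gradients do, and their weighted sum over $i$ vanishes by `hs`. -/
theorem affDiv_eq_zero_of_sum_eq_zero {T : Affine.Simplex ℝ E3 3} {z : E3} (hz : z ∈ T.interior)
    {p : Fin 4 → E3 →ᵃ[ℝ] SymMat} (hj : JumpFree T z p)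
    (h0 : ∀ i, ∀ x ∈ facet T i, (p i x).1 *ᵥ gradLam T i = 0)
    (hs : ∑ i, lam T i z • p i z = 0) (i : Fin 4) : affDiv (p i) = 0 := by
  have key (r : Fin 3) : ((p i z).1 *ᵥ gradLam T i) r = 0 := by
    refine normalDerivative_eq_zero (sum_lam T z)
      (a := fun i j => ((p i z).1 *ᵥ gradLam T j) r) (fun i => ?_) (fun j => ?_) (fun i j => ?_) i
    · rw [← Finset.sum_apply, ← Matrix.mulVec_sum, sum_gradLam, Matrix.mulVec_zero]; rfl
    · have h := congrArg (fun M : SymMat => (M.1 *ᵥ gradLam T j) r) hs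
      simp only [Submodule.coe_sum, Submodule.coe_smul, Matrix.sum_mulVec, Finset.sum_apply,
        Matrix.smul_mulVec, Pi.smul_apply, smul_eq_mul, Submodule.coe_zero, Matrix.zero_mulVec,
        Pi.zero_apply] at h
      exact h
    · by_cases hij : i = j
      · subst hij; ring
      have h := congrFun (hj i j hij 0) r
      simpa only [facePoint_zero, toVec_faceNormal, Matrix.mulVec_sub, Matrix.mulVec_smul,
        Pi.sub_apply, Pi.smul_apply, smul_eq_mul] using h
  rw [affDiv_eq hz hj h0]
  have h2 : (p i z).1 *ᵥ gradLam T i = 0 := funext key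
  rw [piece_eq_lam_smul hz hj h0, Submodule.coe_smul, Matrix.smul_mulVec] at h2
  exact (smul_eq_zero.1 h2).resolve_left (lam_pos_of_mem_interior hz i).ne'

/-! ### The integral of a field with vanishing normal trace. -/

/-- The half-space that cuts the unit simplex out of the nonnegative orthant. -/
def unitSimplex : Set (Fin 3 → ℝ) := {ξ | ∑ m, ξ m ≤ 1}

/-- One factor $\lambda_i(z)$ is from the Jacobian, the other from
$\lambda_i=\lambda_i(z)(1-\sum_m\xi_m)$ in cone coordinates. The remaining constant does not depend
on `i`, and only its positivity matters. -/
theorem setIntegral_alfeldTet_lam {T : Affine.Simplex ℝ E3 3} {z : E3} (hz : z ∈ T.interior)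
    (i : Fin 4) : ∫ y in alfeldTet T z i, lam T i y = lam T i z * lam T i z * (volFactor T z *
      ∫ ξ in Set.Ici (0 : Fin 3 → ℝ), unitSimplex.indicator (fun ξ => 1 - ∑ m, ξ m) ξ) := by
  have hpos := lam_pos_of_mem_interior hz
  have e1 : ∫ y in alfeldTet T z i, lam T i y =
      ∫ y in alfeldTet T z i, (tet T).indicator (lam T i) y := by
    refine setIntegral_congr_fun (measurableSet_alfeldTet T z i) fun y hy => ?_
    rw [Set.indicator_of_mem ((mem_alfeldTet_iff hz i y).1 hy).1]
  rw [e1, setIntegral_alfeldTet_eq_sec hz i fun x hx => Set.indicator_of_notMem hx _,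
    setIntegral_sec hz]
  have e2 : ∫ ξ in Set.Ici (0 : Fin 3 → ℝ), (tet T).indicator (lam T i) (secParam T z i ξ) =
      ∫ ξ in Set.Ici (0 : Fin 3 → ℝ),
        lam T i z * unitSimplex.indicator (fun ξ => 1 - ∑ m, ξ m) ξ := by
    refine setIntegral_congr_fun measurableSet_Ici fun ξ hξ => ?_
    have hmem : secParam T z i ξ ∈ tet T ↔ ξ ∈ unitSimplex := by
      rw [mem_tet_iff, Fin.forall_iff_succAbove i, lam_secParam_self]
      simp only [lam_secParam_succAbove, mul_nonneg_iff_of_pos_left (hpos i), sub_nonneg]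
      refine ⟨fun h => h.1, fun h => ⟨h, fun m => ?_⟩⟩
      exact add_nonneg (mul_nonneg (hpos _).le (sub_nonneg.2 h)) (hξ m)
    by_cases h : ξ ∈ unitSimplex
    · simp only [Set.indicator_of_mem h, Set.indicator_of_mem (hmem.2 h), lam_secParam_self]
    · simp only [Set.indicator_of_notMem h, Set.indicator_of_notMem (mt hmem.1 h), mul_zero]
  rw [e2, integral_const_mul]
  ring

theorem unitSimplex_integral_pos :
    0 < ∫ ξ in Set.Ici (0 : Fin 3 → ℝ), unitSimplex.indicator (fun ξ => 1 - ∑ m, ξ m) ξ := by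
  have hm : MeasurableSet unitSimplex :=
    (isClosed_le (continuous_finsetSum _ fun m _ => continuous_apply m)
      continuous_const).measurableSet
  have hcont : Continuous fun ξ : Fin 3 → ℝ => 1 - ∑ m, ξ m :=
    continuous_const.sub (continuous_finsetSum _ fun m _ => continuous_apply m)
  have hsub : Set.Ici (0 : Fin 3 → ℝ) ∩ unitSimplex ⊆ Set.Icc 0 1 := by
    rintro ξ ⟨h1, h2⟩
    exact ⟨h1, fun m => (Finset.single_le_sum (fun m _ => h1 m) (Finset.mem_univ m)).trans h2⟩
  have hint : IntegrableOn (unitSimplex.indicator fun ξ => 1 - ∑ m, ξ m)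
      (Set.Ici (0 : Fin 3 → ℝ)) := by
    rw [IntegrableOn, integrable_indicator_iff hm, IntegrableOn, Measure.restrict_restrict hm,
      Set.inter_comm]
    exact (hcont.continuousOn.integrableOn_compact isCompact_Icc).mono_set hsub
  have hnn : 0 ≤ unitSimplex.indicator fun ξ => 1 - ∑ m, ξ m :=
    fun ξ => Set.indicator_nonneg (fun ξ hξ => sub_nonneg.2 hξ) ξ
  rw [setIntegral_pos_iff_support_of_nonneg_ae (Filter.Eventually.of_forall hnn) hint]
  set U : Set (Fin 3 → ℝ) := {ξ | (∀ m, 0 < ξ m) ∧ ∑ m, ξ m < 1} with hU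
  have hUo : IsOpen U := by
    refine IsOpen.and ?_ (isOpen_lt (continuous_finsetSum _ fun n _ => continuous_apply n)
      continuous_const)
    simp only [Set.ofPred_forall]
    exact isOpen_iInter_of_finite fun n => isOpen_lt continuous_const (continuous_apply n)
  refine (hUo.measure_pos volume ⟨fun _ => 1 / 4, fun _ => by norm_num, by norm_num⟩).trans_le
    (measure_mono fun ξ hξ => ⟨?_, fun m => (hξ.1 m).le⟩)
  rw [Function.mem_support, Set.indicator_of_mem (show ξ ∈ unitSimplex from hξ.2.le)]
  exact (sub_pos.2 hξ.2).ne'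

theorem matIntegral_apply_of_pieces {T : Affine.Simplex ℝ E3 3} {z : E3} (hz : z ∈ T.interior)
    {ω : E3 → SymMat} {p : Fin 4 → E3 →ᵃ[ℝ] SymMat} (hp : ∀ i, IsPiece T z ω i (p i))
    (r c : Fin 3) : (matIntegral T ω).1 r c = ∑ i, ∫ y in alfeldTet T z i, entry (p i) r c y := by
  have hae (i : Fin 4) : (fun x => (ω x).1 r c) =ᵐ[volume.restrict (alfeldTet T z i)]
      entry (p i) r c := by
    filter_upwards [hp i] with x hx
    rw [hx]; rfl
  have h : (matIntegral T ω).1 r c = ∫ x in tet T, (ω x).1 r c := rfl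
  rw [h, setIntegral_tet hz fun i => ((AffineMap.continuous_of_finiteDimensional
    (entry (p i) r c)).continuousOn.integrableOn_compact
      (isCompact_alfeldTet T z i)).congr_fun_ae (hae i).symm]
  exact Finset.sum_congr rfl fun i _ => integral_congr_ae (hae i)

/-- The integral is a positive multiple of $\sum_i\lambda_i(z)^2A_i=\sum_i\lambda_i(z)p_i(z)$, so
the problem reduces to the divergence-free case. -/
theorem eq_zero_of_matIntegral_eq_zero {T : Affine.Simplex ℝ E3 3} {z : E3} (hz : z ∈ T.interior)
    {ω : E3 → SymMat} {p : Fin 4 → E3 →ᵃ[ℝ] SymMat} (hp : ∀ i, IsPiece T z ω i (p i))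
    (hj : JumpFree T z p) (h0 : ∀ i, ∀ x ∈ facet T i, (p i x).1 *ᵥ gradLam T i = 0)
    (hm : matIntegral T ω = 0) (i : Fin 4) : p i = 0 := by
  refine eq_zero_of_affDiv_eq_zero hz hj h0 (affDiv_eq_zero_of_sum_eq_zero hz hj h0 ?_) i
  refine Subtype.ext (Matrix.ext fun r c => ?_)
  have h1 := matIntegral_apply_of_pieces hz hp r c
  have h2 (i : Fin 4) (y : E3) : entry (p i) r c y = lam T i y * (p i (T.points i)).1 r c := by
    rw [entry_apply, piece_eq_lam_smul hz hj h0]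
    rfl
  rw [hm] at h1
  simp only [h2, integral_mul_const, setIntegral_alfeldTet_lam hz] at h1
  set κ := volFactor T z *
      ∫ ξ in Set.Ici (0 : Fin 3 → ℝ), unitSimplex.indicator (fun ξ => 1 - ∑ m, ξ m) ξ with hκ
  have hκ0 : κ ≠ 0 := (mul_pos (volFactor_pos hz) unitSimplex_integral_pos).ne'
  have h3 : (∑ i, lam T i z • p i z).1 r c * κ = 0 := by
    rw [← show (0 : SymMat).1 r c = (0 : ℝ) from rfl, h1, Submodule.coe_sum, Matrix.sum_apply, Finset.sum_mul]
    refine Finset.sum_congr rfl fun i _ => ?_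
    rw [piece_eq_lam_smul hz hj h0 i z]
    change lam T i z * (lam T i z * (p i (T.points i)).1 r c) * κ = _
    ring
  exact (mul_eq_zero.1 h3).resolve_right hκ0

/-! ### The area measure on a facet. -/

/-- The linear part of the parametrization of the plane of a facet. -/
def facetLin (T : Affine.Simplex ℝ E3 3) (i : Fin 4) : EuclideanSpace ℝ (Fin 2) →ₗ[ℝ] E3 :=
  ∑ n : Fin 2, (EuclideanSpace.proj n : EuclideanSpace ℝ (Fin 2) →L[ℝ] ℝ).toLinearMap.smulRight
    (T.points (i.succAbove n.succ) - T.points (i.succAbove 0))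

/-- The parametrization of the plane of a facet. -/
def facetParam (T : Affine.Simplex ℝ E3 3) (i : Fin 4) (η : EuclideanSpace ℝ (Fin 2)) : E3 :=
  T.points (i.succAbove 0) + facetLin T i η

theorem facetParam_eq (T : Affine.Simplex ℝ E3 3) (i : Fin 4) (η : EuclideanSpace ℝ (Fin 2)) :
    facetParam T i η = T.points (i.succAbove 0) +
      ∑ n : Fin 2, η n • (T.points (i.succAbove n.succ) - T.points (i.succAbove 0)) := by
  simp [facetParam, facetLin]

theorem lam_facetParam_succ (T : Affine.Simplex ℝ E3 3) (i : Fin 4)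
    (η : EuclideanSpace ℝ (Fin 2)) (n : Fin 2) :
    lam T (i.succAbove n.succ) (facetParam T i η) = η n := by
  rw [facetParam_eq, lam_add_sum]
  simp [lam_points]

theorem lam_facetParam_zero (T : Affine.Simplex ℝ E3 3) (i : Fin 4)
    (η : EuclideanSpace ℝ (Fin 2)) :
    lam T (i.succAbove 0) (facetParam T i η) = 1 - ∑ n, η n := by
  rw [facetParam_eq, lam_add_sum]
  simp [lam_points, (Fin.succ_ne_zero _).symm]

theorem lam_facetParam_self (T : Affine.Simplex ℝ E3 3) (i : Fin 4)
    (η : EuclideanSpace ℝ (Fin 2)) : lam T i (facetParam T i η) = 0 := by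
  rw [facetParam_eq, lam_add_sum]
  simp [lam_points, (Fin.succAbove_ne i _).symm]

theorem ext_lam (T : Affine.Simplex ℝ E3 3) {x y : E3} (h : ∀ j, lam T j x = lam T j y) :
    x = y := by
  rw [← sum_lam_smul T x, ← sum_lam_smul T y]
  simp only [h]

theorem facetLin_injective (T : Affine.Simplex ℝ E3 3) (i : Fin 4) :
    Function.Injective (facetLin T i) := by
  intro η η' h
  have h' : facetParam T i η = facetParam T i η' := by rw [facetParam, facetParam, h]
  ext n
  rw [← lam_facetParam_succ T i η, h', lam_facetParam_succ]

/-- Two-sided Lipschitz bounds replace an area formula: only finiteness of the facet area and the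
transfer of null sets to the plane are needed. -/
theorem exists_antilipschitzWith_facetParam (T : Affine.Simplex ℝ E3 3) (i : Fin 4) :
    ∃ K, AntilipschitzWith K (facetParam T i) := by
  obtain ⟨K, -, hK⟩ := (facetLin T i).exists_antilipschitzWith
    (LinearMap.ker_eq_bot.2 (facetLin_injective T i))
  exact ⟨K, fun x y => by simpa [facetParam] using hK x y⟩

theorem exists_lipschitzWith_facetParam (T : Affine.Simplex ℝ E3 3) (i : Fin 4) :
    ∃ K, LipschitzWith K (facetParam T i) := by
  refine ⟨‖LinearMap.toContinuousLinearMap (facetLin T i)‖₊, fun x y => ?_⟩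
  simpa [facetParam] using (LinearMap.toContinuousLinearMap (facetLin T i)).lipschitz x y

theorem isCompact_facet (T : Affine.Simplex ℝ E3 3) (i : Fin 4) : IsCompact (facet T i) := by
  rw [facet, ← Affine.Simplex.convexHull_eq_closedInterior]
  exact (Set.finite_range _).isCompact_convexHull ℝ

instance (T : Affine.Simplex ℝ E3 3) (i : Fin 4) : CompactSpace (facet T i) :=
  isCompact_iff_compactSpace.1 (isCompact_facet T i)

theorem exists_facetParam_eq (T : Affine.Simplex ℝ E3 3) (i : Fin 4) {x : E3}
    (hx : lam T i x = 0) :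
    facetParam T i (WithLp.toLp 2 fun n : Fin 2 => lam T (i.succAbove n.succ) x) = x := by
  refine ext_lam T fun j => ?_
  rcases Fin.eq_self_or_eq_succAbove i j with rfl | ⟨m, rfl⟩
  · rw [lam_facetParam_self, hx]
  · refine Fin.cases ?_ (fun n => ?_) m
    · rw [lam_facetParam_zero]
      have := sum_lam T x
      rw [Fin.sum_univ_succAbove _ i, hx, Fin.sum_univ_succ] at this
      simp only
      linarith
    · rw [lam_facetParam_succ]

/-- The area measure on a facet. -/
def facetMeasure (T : Affine.Simplex ℝ E3 3) (i : Fin 4) : Measure (facet T i) :=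
  (Measure.euclideanHausdorffMeasure 2 : Measure E3).comap Subtype.val

theorem euclideanHausdorffMeasure_facet_lt_top (T : Affine.Simplex ℝ E3 3) (i : Fin 4) :
    (Measure.euclideanHausdorffMeasure 2 : Measure E3) (facet T i) < ⊤ := by
  obtain ⟨K, hK⟩ := exists_lipschitzWith_facetParam T i
  set Λ : E3 → EuclideanSpace ℝ (Fin 2) :=
    fun x => WithLp.toLp 2 fun n : Fin 2 => lam T (i.succAbove n.succ) x with hΛ
  have hΛc : Continuous Λ :=
    (PiLp.continuous_toLp 2 _).comp (continuous_pi fun n => lam_continuous T _)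
  have hsub : facet T i ⊆ facetParam T i '' (Λ '' facet T i) := fun x hx =>
    ⟨Λ x, ⟨x, hx, rfl⟩, exists_facetParam_eq T i ((mem_facet_iff T i x).1 hx).1⟩
  have hfin : (volume : Measure (EuclideanSpace ℝ (Fin 2))) (Λ '' facet T i) < ⊤ :=
    ((isCompact_facet T i).image hΛc).measure_lt_top
  rw [← EuclideanSpace.euclideanHausdorffMeasure_eq_volume,
    Measure.euclideanHausdorffMeasure_def, Measure.smul_apply, ENNReal.smul_def, smul_eq_mul,
    ENNReal.mul_lt_top_iff] at hfin
  have hne := Measure.addHaarScalarFactor_volume_hausdorffMeasure_ne_zero 2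
  have hfin' : Measure.hausdorffMeasure ((2 : ℕ) : ℝ) (Λ '' facet T i) < ⊤ := by
    rcases hfin with h | h | h
    · exact h.2
    · exact absurd (ENNReal.coe_eq_zero.1 h) hne
    · rw [h]; exact ENNReal.zero_lt_top
  rw [Measure.euclideanHausdorffMeasure_def, Measure.smul_apply, ENNReal.smul_def, smul_eq_mul]
  refine ENNReal.mul_lt_top ENNReal.coe_lt_top ((measure_mono hsub).trans_lt ?_)
  refine (hK.hausdorffMeasure_image_le (by positivity) _).trans_lt (ENNReal.mul_lt_top ?_ hfin')
  exact ENNReal.rpow_lt_top_of_nonneg (by positivity) ENNReal.coe_ne_top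

theorem facetMeasure_apply (T : Affine.Simplex ℝ E3 3) (i : Fin 4) (s : Set (facet T i)) :
    facetMeasure T i s =
      (Measure.euclideanHausdorffMeasure 2 : Measure E3) (Subtype.val '' s) :=
  (MeasurableEmbedding.subtype_coe (isCompact_facet T i).measurableSet).comap_apply _ _

instance (T : Affine.Simplex ℝ E3 3) (i : Fin 4) : IsFiniteMeasure (facetMeasure T i) :=
  ⟨by
    rw [facetMeasure_apply, Set.image_univ, Subtype.range_coe]
    exact euclideanHausdorffMeasure_facet_lt_top T i⟩

/-- The parametrization of the plane of a facet as an affine map. -/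
def facetParamAff (T : Affine.Simplex ℝ E3 3) (i : Fin 4) : EuclideanSpace ℝ (Fin 2) →ᵃ[ℝ] E3 :=
  (facetLin T i).toAffineMap + AffineMap.const ℝ _ (T.points (i.succAbove 0))

theorem facetParamAff_apply (T : Affine.Simplex ℝ E3 3) (i : Fin 4)
    (η : EuclideanSpace ℝ (Fin 2)) : facetParamAff T i η = facetParam T i η := by
  simp [facetParamAff, facetParam, add_comm]

/-- The antilipschitz bound carries the null set back to the parameter plane, where an affine
function vanishing almost everywhere on an open triangle is zero. This makes the $L^2$ pairing on
the facet definite. -/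
theorem eq_zero_of_ae_facetMeasure (T : Affine.Simplex ℝ E3 3) (i : Fin 4) (f : E3 →ᵃ[ℝ] ℝ)
    (h : ∀ᵐ x ∂facetMeasure T i, f x.1 = 0) : ∀ x ∈ facet T i, f x = 0 := by
  set U : Set (EuclideanSpace ℝ (Fin 2)) := WithLp.ofLp ⁻¹' openTriangle with hU
  have hUo : IsOpen U := isOpen_openTriangle.preimage (PiLp.continuous_ofLp 2 _)
  have hUne : U.Nonempty := by
    obtain ⟨η, hη⟩ := openTriangle_nonempty
    exact ⟨WithLp.toLp 2 η, hη⟩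
  obtain ⟨K, hK⟩ := exists_antilipschitzWith_facetParam T i
  have hne := Measure.addHaarScalarFactor_volume_hausdorffMeasure_ne_zero 2
  have h0 : (volume : Measure (EuclideanSpace ℝ (Fin 2)))
      (U ∩ {η | f (facetParam T i η) ≠ 0}) = 0 := by
    rw [ae_iff, facetMeasure_apply] at h
    have h1 : (Measure.euclideanHausdorffMeasure 2 : Measure E3)
        (facetParam T i '' (U ∩ {η | f (facetParam T i η) ≠ 0})) = 0 := by
      refine measure_mono_null ?_ h
      rintro _ ⟨η, ⟨h1, h2⟩, rfl⟩
      refine ⟨⟨facetParam T i η, (mem_facet_iff T i _).2 ⟨lam_facetParam_self T i η, ?_⟩⟩, h2, rfl⟩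
      intro j
      rcases Fin.eq_self_or_eq_succAbove i j with rfl | ⟨m, rfl⟩
      · rw [lam_facetParam_self]
      · refine Fin.cases ?_ (fun n => ?_) m
        · rw [lam_facetParam_zero]
          exact sub_nonneg.2 h1.2.le
        · rw [lam_facetParam_succ]
          exact (h1.1 n).le
    rw [Measure.euclideanHausdorffMeasure_def, Measure.smul_apply, ENNReal.smul_def, smul_eq_mul,
      mul_eq_zero] at h1
    have h2 := h1.resolve_left (ENNReal.coe_ne_zero.2 hne)
    rw [← EuclideanSpace.euclideanHausdorffMeasure_eq_volume,
      Measure.euclideanHausdorffMeasure_def, Measure.smul_apply, ENNReal.smul_def, smul_eq_mul]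
    refine mul_eq_zero_of_right _ (le_antisymm ?_ zero_le)
    refine (hK.le_hausdorffMeasure_image (by positivity) _).trans ?_
    rw [h2, mul_zero]
  have hae : (fun η => f (facetParamAff T i η)) =ᵐ[volume.restrict U] fun _ => 0 := by
    refine (ae_restrict_iff' hUo.measurableSet).2 ?_
    rw [ae_iff]
    refine measure_mono_null (fun η hη => ?_) h0
    simpa [facetParamAff_apply] using hη
  have hcont : Continuous fun η => f (facetParamAff T i η) :=
    AffineMap.continuous_of_finiteDimensional (f.comp (facetParamAff T i))
  have heq := Measure.eqOn_open_of_ae_eq hae hUo hcont.continuousOn continuousOn_const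
  have hzero : f.comp (facetParamAff T i) = 0 :=
    AffineMap.eq_of_eqOn_open hUo hUne fun η hη => heq hη
  intro x hx
  have h3 := congrArg (fun g : EuclideanSpace ℝ (Fin 2) →ᵃ[ℝ] ℝ =>
    g (WithLp.toLp 2 fun n : Fin 2 => lam T (i.succAbove n.succ) x)) hzero
  simpa [facetParamAff_apply, exists_facetParam_eq T i ((mem_facet_iff T i x).1 hx).1] using h3

/-! ### Dimensions and the count of jump conditions. -/

theorem finrank_symMat : Module.finrank ℝ SymMat = 6 := by
  let e : SymMat ≃ₗ[ℝ] ({q : Fin 3 × Fin 3 // q.1 ≤ q.2} → ℝ) :=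
    { toFun := fun A q => A.1 q.1.1 q.1.2
      map_add' := fun A B => rfl
      map_smul' := fun a A => rfl
      invFun := fun f => ⟨Matrix.of fun r c => f ⟨(min r c, max r c), min_le_max⟩, by
        refine Matrix.IsSymm.ext fun r c => ?_
        simp only [Matrix.of_apply, min_comm r c, max_comm r c]⟩
      left_inv := fun A => by
        refine Subtype.ext (Matrix.ext fun r c => ?_)
        rcases le_total r c with h | h
        · simp [h]
        · simpa [h] using A.2.apply r c
      right_inv := fun f => by
        funext ⟨⟨r, c⟩, h⟩
        have h' : r ≤ c := h
        simp [h'] }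
  rw [e.finrank_eq, Module.finrank_fintype_fun_eq_card]
  decide

/-- Evaluation of a function on a facet at the vertices of the facet. -/
def facetEval (T : Affine.Simplex ℝ E3 3) (i : Fin 4) :
    P1 (facet T i) (Fin 3 → ℝ) →ₗ[ℝ] (Fin 3 → Fin 3 → ℝ) where
  toFun f m := f.1 ⟨T.points (i.succAbove m), points_mem_facet T (Fin.succAbove_ne i m).symm⟩
  map_add' _ _ := rfl
  map_smul' _ _ := rfl

theorem facetEval_bijective (T : Affine.Simplex ℝ E3 3) (i : Fin 4) :
    Function.Bijective (facetEval T i) := by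
  constructor
  · rw [← LinearMap.ker_eq_bot, LinearMap.ker_eq_bot']
    rintro ⟨f, p, hp⟩ hf
    refine Subtype.ext (funext fun x => ?_)
    change f x = 0
    rw [hp x, AffineMap.apply_eq_sum_lam T, Fin.sum_univ_succAbove _ i,
      ((mem_facet_iff T i x).1 x.2).1, zero_smul, zero_add]
    refine Finset.sum_eq_zero fun m _ => ?_
    have h : f ⟨T.points (i.succAbove m), points_mem_facet T (Fin.succAbove_ne i m).symm⟩ = 0 :=
      congrFun hf m
    rw [hp] at h
    rw [h, smul_zero]
  · intro c
    set p : E3 →ᵃ[ℝ] (Fin 3 → ℝ) := ∑ m, (LinearMap.toSpanSingleton ℝ (Fin 3 → ℝ)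
      (c m)).toAffineMap.comp (lam T (i.succAbove m)) with hp
    refine ⟨⟨fun x => p x, p, fun x => rfl⟩, funext fun m => ?_⟩
    change p (T.points (i.succAbove m)) = c m
    have h (y : E3) : p y = ∑ m, lam T (i.succAbove m) y • c m := by
      rw [hp]
      simp [Fin.sum_univ_three]
    rw [h]
    simp [lam_points]

/-- The polynomials of degree at most one on a facet, by their values at the vertices. -/
def facetEquiv (T : Affine.Simplex ℝ E3 3) (i : Fin 4) :
    P1 (facet T i) (Fin 3 → ℝ) ≃ₗ[ℝ] (Fin 3 → Fin 3 → ℝ) :=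
  LinearEquiv.ofBijective (facetEval T i) (facetEval_bijective T i)

instance (T : Affine.Simplex ℝ E3 3) (i : Fin 4) :
    FiniteDimensional ℝ (P1 (facet T i) (Fin 3 → ℝ)) :=
  (facetEquiv T i).symm.finiteDimensional

theorem finrank_P1_facet (T : Affine.Simplex ℝ E3 3) (i : Fin 4) :
    Module.finrank ℝ (P1 (facet T i) (Fin 3 → ℝ)) = 9 := by
  rw [(facetEquiv T i).finrank_eq, Module.finrank_pi_fintype]
  simp

instance : FiniteDimensional ℝ (E3 →ᵃ[ℝ] SymMat) :=
  (AffineMap.toConstProdLinearMap ℝ (V1 := E3) (V2 := SymMat)).symm.finiteDimensional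

theorem finrank_affineMap_symMat : Module.finrank ℝ (E3 →ᵃ[ℝ] SymMat) = 24 := by
  rw [(AffineMap.toConstProdLinearMap ℝ (V1 := E3) (V2 := SymMat)).finrank_eq, Module.finrank_prod,
    Module.finrank_linearMap, finrank_symMat]
  simp

/-- The points at which the normal continuity is imposed: the vertices of the unit triangle. -/
def triangleVertex : Fin 3 → Fin 2 → ℝ := ![0, Pi.single 0 1, Pi.single 1 1]

/-- The normal jumps at the vertices of the common faces of the cells. -/
def jumpMap (T : Affine.Simplex ℝ E3 3) (z : E3) :
    (Fin 4 → E3 →ᵃ[ℝ] SymMat) →ₗ[ℝ]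
      ({q : Fin 4 × Fin 4 // q.1 < q.2} → Fin 3 → Fin 3 → ℝ) where
  toFun p q a := (p q.1.1 (facePoint T z q.1.1 q.1.2 (triangleVertex a)) -
    p q.1.2 (facePoint T z q.1.1 q.1.2 (triangleVertex a))).1 *ᵥ toVec (faceNormal T z q.1.1 q.1.2)
  map_add' p p' := by
    funext q a
    simp only [Pi.add_apply, AffineMap.coe_add]
    rw [add_sub_add_comm, Submodule.coe_add, Matrix.add_mulVec]
  map_smul' t p := by
    funext q a
    simp only [Pi.smul_apply, AffineMap.coe_smul, RingHom.id_apply]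
    rw [← smul_sub, Submodule.coe_smul, Matrix.smul_mulVec]

theorem AffineMap.eq_zero_of_triangleVertex {f : (Fin 2 → ℝ) →ᵃ[ℝ] ℝ}
    (h : ∀ a, f (triangleVertex a) = 0) : f = 0 := by
  have h0 : f 0 = 0 := h 0
  have h1 : f (Pi.single 0 1) = 0 := h 1
  have h2 : f (Pi.single 1 1) = 0 := h 2
  have hd (η : Fin 2 → ℝ) : f η = f.linear η := by
    rw [← add_zero (f.linear η), ← h0]
    exact congrFun (AffineMap.decomp f) η
  rw [hd] at h1 h2
  have hl : f.linear = 0 := by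
    refine LinearMap.pi_ext' fun n => LinearMap.ext_ring ?_
    fin_cases n
    · simpa using h1
    · simpa using h2
  refine AffineMap.ext fun η => ?_
  rw [hd, hl]
  rfl

/-- An affine jump is determined by its values at three vertices of the face, and swapping the cells
only changes the sign of the normal; so finitely many conditions on ordered pairs suffice. -/
theorem jumpFree_iff (T : Affine.Simplex ℝ E3 3) (z : E3) (p : Fin 4 → E3 →ᵃ[ℝ] SymMat) :
    JumpFree T z p ↔ p ∈ LinearMap.ker (jumpMap T z) := by
  rw [LinearMap.mem_ker]
  constructor
  · intro h
    funext ⟨⟨i, j⟩, hij⟩ a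
    change ((p i _).1 - (p j _).1) *ᵥ _ = 0
    rw [Matrix.sub_mulVec, h i j (ne_of_lt hij), sub_self]
  · intro h
    have key (i j : Fin 4) (hij : i < j) (η : Fin 2 → ℝ) :
        (p i (facePoint T z i j η)).1 *ᵥ toVec (faceNormal T z i j) =
          (p j (facePoint T z i j η)).1 *ᵥ toVec (faceNormal T z i j) := by
      funext r
      have h1 : (rowAff (p i) (toVec (faceNormal T z i j)) r -
          rowAff (p j) (toVec (faceNormal T z i j)) r).comp (facePointAff T z i j) = 0 := by
        refine AffineMap.eq_zero_of_triangleVertex fun a => ?_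
        have h2 := congrFun (congrFun (congrFun h ⟨(i, j), hij⟩) a) r
        change (((p i _).1 - (p j _).1) *ᵥ _) r = 0 at h2
        rw [Matrix.sub_mulVec, Pi.sub_apply, ← rowAff_apply, ← rowAff_apply] at h2
        simpa [facePointAff_apply] using h2
      have h3 := congrArg (fun f : (Fin 2 → ℝ) →ᵃ[ℝ] ℝ => f η) h1
      rw [← sub_eq_zero]
      simpa [facePointAff_apply, rowAff_apply] using h3
    intro i j hij η
    rcases lt_or_gt_of_ne hij with h1 | h1
    · exact key i j h1 η
    · rw [facePoint_comm T z hij, toVec_faceNormal_swap, Matrix.mulVec_neg, Matrix.mulVec_neg,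
        key j i h1 η]

/-- Rank-nullity with 96 unknowns and 54 conditions. Independence of the conditions is not needed
here; it follows from the opposite bound. -/
theorem le_finrank_ker_jumpMap (T : Affine.Simplex ℝ E3 3) (z : E3) :
    42 ≤ Module.finrank ℝ (LinearMap.ker (jumpMap T z)) := by
  have h1 := LinearMap.finrank_range_add_finrank_ker (jumpMap T z)
  have h2 : Module.finrank ℝ (Fin 4 → E3 →ᵃ[ℝ] SymMat) = 96 := by
    rw [Module.finrank_pi_fintype]
    simp [finrank_affineMap_symMat]
  have h3 : Module.finrank ℝ ({q : Fin 4 × Fin 4 // q.1 < q.2} → Fin 3 → Fin 3 → ℝ) = 54 := by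
    rw [Module.finrank_pi_fintype]
    have hc : Fintype.card {q : Fin 4 × Fin 4 // q.1 < q.2} = 6 := by decide
    simp only [Module.finrank_pi_fintype, Module.finrank_self, Finset.sum_const, Finset.card_univ, hc,
      Fintype.card_fin, smul_eq_mul]
  have h4 := Submodule.finrank_le (LinearMap.range (jumpMap T z))
  omega

/-! ### Classes of fields and their polynomial pieces. -/

/-- The cell has nonempty interior, so its almost-everywhere values fix the polynomial. The choice
in `piece` is therefore immaterial, and `piece` depends linearly on the class. -/
theorem IsPiece.eq {T : Affine.Simplex ℝ E3 3} {z : E3} (hz : z ∈ T.interior) {ω : E3 → SymMat}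
    {i : Fin 4} {p q : E3 →ᵃ[ℝ] SymMat} (hp : IsPiece T z ω i p) (hq : IsPiece T z ω i q) :
    p = q := by
  have hae : ∀ᵐ x ∂volume.restrict (openCell T z i), p x = q x := by
    rw [Measure.restrict_congr_set (openCell_ae_eq hz i)]
    filter_upwards [hp, hq] with x h1 h2
    rw [← h1, ← h2]
  refine AffineMap.eq_of_eqOn_open (isOpen_openCell T z i) (openCell_nonempty hz i)
    fun x hx => Subtype.ext (Matrix.ext fun r c => ?_)
  have hae' : entry p r c =ᵐ[volume.restrict (openCell T z i)] entry q r c := by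
    filter_upwards [hae] with x hx
    rw [entry_apply, entry_apply, hx]
  exact Measure.eqOn_open_of_ae_eq hae' (isOpen_openCell T z i)
    (AffineMap.continuous_of_finiteDimensional _).continuousOn
    (AffineMap.continuous_of_finiteDimensional _).continuousOn hx

theorem IsPiece.piece_eq {T : Affine.Simplex ℝ E3 3} {z : E3} (hz : z ∈ T.interior)
    {ω : E3 → SymMat} {i : Fin 4} {p : E3 →ᵃ[ℝ] SymMat} (hp : IsPiece T z ω i p) :
    piece T z ω i = p := by
  have h : ∃ p, IsPiece T z ω i p := ⟨p, hp⟩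
  rw [piece, dif_pos h]
  exact h.choose_spec.eq hz hp

theorem isPiece_piece {T : Affine.Simplex ℝ E3 3} {z : E3} {hz : z ∈ T.interior}
    {ω : E3 →ₘ[volume.restrict (tet T)] SymMat} (hω : ω ∈ SigmaH T z hz) (i : Fin 4) :
    IsPiece T z ω i (piece T z ω i) := by
  obtain ⟨p, hp⟩ := hω.2 i
  rwa [hp.piece_eq hz]

theorem jumpFree_piece {T : Affine.Simplex ℝ E3 3} {z : E3} {hz : z ∈ T.interior}
    {ω : E3 →ₘ[volume.restrict (tet T)] SymMat} (hω : ω ∈ SigmaH T z hz) :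
    JumpFree T z (piece T z ω) := by
  obtain ⟨g, hg, hw⟩ := hω.1.2
  exact jumpFree_of_isWeakDiv hz (isPiece_piece hω) hg hw

/-- The polynomial pieces of an element of `Σ_h(T)`. -/
def pieceMap (T : Affine.Simplex ℝ E3 3) (z : E3) (hz : z ∈ T.interior) :
    SigmaH T z hz →ₗ[ℝ] LinearMap.ker (jumpMap T z) where
  toFun ω := ⟨piece T z ω.1, (jumpFree_iff T z _).1 (jumpFree_piece ω.2)⟩
  map_add' ω τ := by
    refine Subtype.ext (funext fun i => IsPiece.piece_eq hz ?_)
    have key := ae_restrict_of_ae_restrict_of_subset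
      (alfeldTet_subset (T.interior_subset_closedInterior hz) i) (AEEqFun.coeFn_add ω.1 τ.1)
    filter_upwards [isPiece_piece ω.2 i, isPiece_piece τ.2 i, key] with x h1 h2 h3
    rw [Submodule.coe_add, h3, Pi.add_apply, h1, h2]
    rfl
  map_smul' a ω := by
    refine Subtype.ext (funext fun i => IsPiece.piece_eq hz ?_)
    have key := ae_restrict_of_ae_restrict_of_subset
      (alfeldTet_subset (T.interior_subset_closedInterior hz) i) (AEEqFun.coeFn_smul a ω.1)
    filter_upwards [isPiece_piece ω.2 i, key] with x h1 h3
    rw [Submodule.coe_smul, h3, Pi.smul_apply, h1]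
    rfl

theorem eq_of_pieces {T : Affine.Simplex ℝ E3 3} {z : E3} (hz : z ∈ T.interior)
    {ω τ : E3 →ₘ[volume.restrict (tet T)] SymMat} {p : Fin 4 → E3 →ᵃ[ℝ] SymMat}
    (h1 : ∀ i, IsPiece T z ω i (p i)) (h2 : ∀ i, IsPiece T z τ i (p i)) : ω = τ := by
  refine AEEqFun.ext (ae_tet_of_forall_alfeldTet hz fun i => ?_)
  filter_upwards [h1 i, h2 i] with x h3 h4
  rw [h3, h4]

instance : TopologicalSpace.PseudoMetrizableSpace SymMat :=
  Topology.IsInducing.pseudoMetrizableSpace (Y := Fin 3 → Fin 3 → ℝ) (f := Subtype.val)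
    Topology.IsInducing.subtypeVal

theorem exists_sigmaH_of_jumpFree {T : Affine.Simplex ℝ E3 3} {z : E3} (hz : z ∈ T.interior)
    {p : Fin 4 → E3 →ᵃ[ℝ] SymMat} (hp : JumpFree T z p) :
    ∃ ω ∈ SigmaH T z hz, ∀ i, IsPiece T z ω i (p i) := by
  set w : E3 → SymMat := glue T z fun i => p i with hw
  have hae := glue_ae_eq hz (fun i => (p i : E3 → SymMat))
  have hm : AEStronglyMeasurable w (volume.restrict (tet T)) := by
    rw [tet_eq_iUnion hz, aestronglyMeasurable_iUnion_iff]
    intro i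
    have hi : (p i : E3 → SymMat) =ᵐ[volume.restrict (alfeldTet T z i)] w :=
      Filter.EventuallyEq.symm (hae i)
    have hc : Continuous (p i : E3 → SymMat) := by
      refine Continuous.subtype_mk (continuous_pi fun r => continuous_pi fun c => ?_) _
      exact AffineMap.continuous_of_finiteDimensional (entry (p i) r c)
    exact hc.aestronglyMeasurable.congr hi
  have hpiece (i : Fin 4) : IsPiece T z (AEEqFun.mk w hm) i (p i) := by
    have key := ae_restrict_of_ae_restrict_of_subset
      (alfeldTet_subset (T.interior_subset_closedInterior hz) i) (AEEqFun.coeFn_mk w hm)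
    filter_upwards [key, hae i] with x h1 h2
    rw [h1, hw, h2]
  exact ⟨AEEqFun.mk w hm, ⟨⟨isL2Mat_of_pieces hz hpiece, _, isL2Vec_glue hz _,
    isWeakDiv_of_jumpFree hz hpiece hp⟩, fun i => ⟨p i, hpiece i⟩⟩, hpiece⟩

theorem pieceMap_bijective (T : Affine.Simplex ℝ E3 3) (z : E3) (hz : z ∈ T.interior) :
    Function.Bijective (pieceMap T z hz) := by
  constructor
  · intro ω τ h
    have h' : piece T z ω.1 = piece T z τ.1 := congrArg Subtype.val h
    refine Subtype.ext (eq_of_pieces hz (isPiece_piece ω.2) fun i => ?_)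
    rw [h']
    exact isPiece_piece τ.2 i
  · rintro ⟨p, hp⟩
    obtain ⟨ω, hω, h⟩ := exists_sigmaH_of_jumpFree hz ((jumpFree_iff T z p).2 hp)
    exact ⟨⟨ω, hω⟩, Subtype.ext (funext fun i => (h i).piece_eq hz)⟩

/-- The elements of `Σ_h(T)` correspond to the normally continuous families of affine fields. -/
def pieceEquiv (T : Affine.Simplex ℝ E3 3) (z : E3) (hz : z ∈ T.interior) :
    SigmaH T z hz ≃ₗ[ℝ] LinearMap.ker (jumpMap T z) :=
  LinearEquiv.ofBijective (pieceMap T z hz) (pieceMap_bijective T z hz)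

/-! ### Degrees of freedom and unisolvence. -/

theorem continuous_of_mem_P1 {T : Affine.Simplex ℝ E3 3} {i : Fin 4} {f : facet T i → Fin 3 → ℝ}
    (hf : f ∈ P1 (facet T i) (Fin 3 → ℝ)) : Continuous f := by
  obtain ⟨p, hp⟩ := hf
  rw [show f = fun x => p x.1 from funext hp]
  exact (AffineMap.continuous_of_finiteDimensional p).comp continuous_subtype_val

theorem integrable_dotProduct {T : Affine.Simplex ℝ E3 3} {i : Fin 4}
    (f g : P1 (facet T i) (Fin 3 → ℝ)) :
    Integrable (fun x => f.1 x ⬝ᵥ g.1 x) (facetMeasure T i) := by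
  have h : Continuous fun x => f.1 x ⬝ᵥ g.1 x :=
    (continuous_of_mem_P1 f.2).dotProduct (continuous_of_mem_P1 g.2)
  exact h.integrable_of_hasCompactSupport (HasCompactSupport.of_compactSpace _)

/-- The `L²` inner product on the polynomials of degree at most one on a facet. -/
def facetForm (T : Affine.Simplex ℝ E3 3) (i : Fin 4) :
    P1 (facet T i) (Fin 3 → ℝ) →ₗ[ℝ] P1 (facet T i) (Fin 3 → ℝ) →ₗ[ℝ] ℝ :=
  LinearMap.mk₂ ℝ (fun f g => ∫ x, f.1 x ⬝ᵥ g.1 x ∂facetMeasure T i)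
    (fun f f' g => by
      rw [← integral_add (integrable_dotProduct f g) (integrable_dotProduct f' g)]
      simp [add_dotProduct])
    (fun a f g => by
      rw [smul_eq_mul, ← integral_const_mul]
      simp [smul_dotProduct])
    (fun f g g' => by
      rw [← integral_add (integrable_dotProduct f g) (integrable_dotProduct f g')]
      simp [dotProduct_add])
    (fun a f g => by
      rw [smul_eq_mul, ← integral_const_mul]
      simp [dotProduct_smul])

theorem facetForm_apply (T : Affine.Simplex ℝ E3 3) (i : Fin 4)
    (f g : P1 (facet T i) (Fin 3 → ℝ)) :
    facetForm T i f g = ∫ x, f.1 x ⬝ᵥ g.1 x ∂facetMeasure T i := rfl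

theorem facetForm_self_eq_zero {T : Affine.Simplex ℝ E3 3} {i : Fin 4}
    {f : P1 (facet T i) (Fin 3 → ℝ)} (h : facetForm T i f f = 0) : f = 0 := by
  have hnn (x : facet T i) : 0 ≤ f.1 x ⬝ᵥ f.1 x :=
    Finset.sum_nonneg fun c _ => mul_self_nonneg _
  rw [facetForm_apply, integral_eq_zero_iff_of_nonneg hnn (integrable_dotProduct f f)] at h
  obtain ⟨p, hp⟩ := f.2
  refine Subtype.ext (funext fun x => funext fun c => ?_)
  have hc := eq_zero_of_ae_facetMeasure T i
    ((LinearMap.proj c : (Fin 3 → ℝ) →ₗ[ℝ] ℝ).toAffineMap.comp p) (by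
      filter_upwards [h] with y hy
      have h1 : f.1 y = 0 := dotProduct_self_eq_zero.1 hy
      rw [hp y] at h1
      exact congrFun h1 c) x x.2
  rw [hp x]
  exact hc

/-- The normal trace of an affine field on a facet. -/
def traceMap (T : Affine.Simplex ℝ E3 3) (i : Fin 4) :
    (E3 →ᵃ[ℝ] SymMat) →ₗ[ℝ] P1 (facet T i) (Fin 3 → ℝ) where
  toFun p := ⟨fun x => (p x).1 *ᵥ (outwardNormal T i).ofLp,
    ((Matrix.mulVecBilin ℝ ℝ).flip (outwardNormal T i).ofLp ∘ₗ SymMat.subtype).toAffineMap.comp p,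
    fun _ => rfl⟩
  map_add' p q := by
    refine Subtype.ext (funext fun x => ?_)
    change (p x + q x : SymMat).1 *ᵥ _ = (p x).1 *ᵥ _ + (q x).1 *ᵥ _
    rw [Submodule.coe_add, Matrix.add_mulVec]
  map_smul' a p := by
    refine Subtype.ext (funext fun x => ?_)
    change (a • p x : SymMat).1 *ᵥ _ = a • ((p x).1 *ᵥ _)
    rw [Submodule.coe_smul, Matrix.smul_mulVec]

theorem mulVec_gradLam_eq_zero {T : Affine.Simplex ℝ E3 3} {i : Fin 4} {p : E3 →ᵃ[ℝ] SymMat}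
    (h : traceMap T i p = 0) : ∀ x ∈ facet T i, (p x).1 *ᵥ gradLam T i = 0 := by
  intro x hx
  have h1 : (p x).1 *ᵥ (outwardNormal T i).ofLp = 0 := congrFun (congrArg Subtype.val h) ⟨x, hx⟩
  rw [outwardNormal_eq, Matrix.mulVec_smul] at h1
  exact (smul_eq_zero.1 h1).resolve_left (neg_ne_zero.2 (T.height_pos i).ne')

theorem integrableOn_entry (T : Affine.Simplex ℝ E3 3) (z : E3) (i : Fin 4)
    (p : E3 →ᵃ[ℝ] SymMat) (r c : Fin 3) :
    Integrable (entry p r c) (volume.restrict (alfeldTet T z i)) :=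
  (AffineMap.continuous_of_finiteDimensional _).continuousOn.integrableOn_compact
    (isCompact_alfeldTet T z i)

/-- The integral over `T` of the field with given pieces. -/
def integralMap (T : Affine.Simplex ℝ E3 3) (z : E3) :
    (Fin 4 → E3 →ᵃ[ℝ] SymMat) →ₗ[ℝ] SymMat where
  toFun p := ⟨Matrix.of fun r c => ∑ i, ∫ y in alfeldTet T z i, entry (p i) r c y, by
    refine Matrix.IsSymm.ext fun r c => ?_
    simp only [Matrix.of_apply, entry_apply]
    refine Finset.sum_congr rfl fun i _ => integral_congr_ae (Filter.Eventually.of_forall fun y => ?_)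
    exact Matrix.IsSymm.apply (p i y).2 r c⟩
  map_add' p q := by
    refine Subtype.ext (Matrix.ext fun r c => ?_)
    change ∑ i, ∫ y in alfeldTet T z i, entry (p i + q i) r c y =
      (∑ i, ∫ y in alfeldTet T z i, entry (p i) r c y) +
        ∑ i, ∫ y in alfeldTet T z i, entry (q i) r c y
    rw [← Finset.sum_add_distrib]
    refine Finset.sum_congr rfl fun i _ => ?_
    rw [← integral_add (integrableOn_entry T z i _ r c) (integrableOn_entry T z i _ r c)]
    rfl
  map_smul' a p := by
    refine Subtype.ext (Matrix.ext fun r c => ?_)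
    change ∑ i, ∫ y in alfeldTet T z i, entry (a • p i) r c y =
      a * ∑ i, ∫ y in alfeldTet T z i, entry (p i) r c y
    rw [Finset.mul_sum]
    refine Finset.sum_congr rfl fun i _ => ?_
    rw [← integral_const_mul]
    rfl

theorem matIntegral_eq {T : Affine.Simplex ℝ E3 3} {z : E3} (hz : z ∈ T.interior)
    {ω : E3 → SymMat} {p : Fin 4 → E3 →ᵃ[ℝ] SymMat} (hp : ∀ i, IsPiece T z ω i (p i)) :
    matIntegral T ω = integralMap T z p :=
  Subtype.ext (Matrix.ext fun r c => matIntegral_apply_of_pieces hz hp r c)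

/-- The degrees of freedom of the normally continuous families of affine fields. -/
def dofMap (T : Affine.Simplex ℝ E3 3) (z : E3) : LinearMap.ker (jumpMap T z) →ₗ[ℝ]
    ((i : Fin 4) → Module.Dual ℝ (P1 (facet T i) (Fin 3 → ℝ))) × SymMat :=
  ((LinearMap.pi fun i => facetForm T i ∘ₗ traceMap T i ∘ₗ LinearMap.proj i).prod
    (integralMap T z)) ∘ₗ (LinearMap.ker (jumpMap T z)).subtype

theorem dofMap_injective {T : Affine.Simplex ℝ E3 3} {z : E3} (hz : z ∈ T.interior) :
    Function.Injective (dofMap T z) := by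
  rw [← LinearMap.ker_eq_bot, LinearMap.ker_eq_bot']
  rintro ⟨p, hp⟩ h
  have hj := (jumpFree_iff T z p).2 hp
  obtain ⟨ω, -, hω⟩ := exists_sigmaH_of_jumpFree hz hj
  have h1 (i : Fin 4) : traceMap T i (p i) = 0 := by
    refine facetForm_self_eq_zero ?_
    -- The normal trace is itself of degree at most one, so it is an admissible test function
    -- against itself.
    exact DFunLike.congr_fun (congrFun (congrArg Prod.fst h) i) (traceMap T i (p i))
  have h2 : integralMap T z p = 0 := congrArg Prod.snd h
  rw [← matIntegral_eq hz hω] at h2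
  exact Subtype.ext (funext fun i =>
    eq_zero_of_matIntegral_eq_zero hz hω hj (fun i => mulVec_gradLam_eq_zero (h1 i)) h2 i)

theorem finrank_dof (T : Affine.Simplex ℝ E3 3) : Module.finrank ℝ
    (((i : Fin 4) → Module.Dual ℝ (P1 (facet T i) (Fin 3 → ℝ))) × SymMat) = 42 := by
  rw [Module.finrank_prod, Module.finrank_pi_fintype, finrank_symMat]
  simp only [Subspace.dual_finrank_eq, finrank_P1_facet]
  simp

/-- Injectivity of the 42 degrees of freedom bounds the dimension from above, and the count of
conditions bounds it from below. -/
theorem finrank_ker_jumpMap {T : Affine.Simplex ℝ E3 3} {z : E3} (hz : z ∈ T.interior) :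
    Module.finrank ℝ (LinearMap.ker (jumpMap T z)) = 42 :=
  le_antisymm ((LinearMap.finrank_le_finrank_of_injective (dofMap_injective hz)).trans_eq
    (finrank_dof T)) (le_finrank_ker_jumpMap T z)

/-- The degrees of freedom are a linear isomorphism. -/
def dofEquiv (T : Affine.Simplex ℝ E3 3) (z : E3) (hz : z ∈ T.interior) : SigmaH T z hz ≃ₗ[ℝ]
    ((i : Fin 4) → Module.Dual ℝ (P1 (facet T i) (Fin 3 → ℝ))) × SymMat :=
  (pieceEquiv T z hz).trans (LinearEquiv.ofInjectiveOfFinrankEq (dofMap T z) (dofMap_injective hz)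
    ((finrank_ker_jumpMap hz).trans (finrank_dof T).symm))

theorem dofEquiv_fst {T : Affine.Simplex ℝ E3 3} {z : E3} {hz : z ∈ T.interior}
    (ω : SigmaH T z hz) (i : Fin 4) (κ : P1 (facet T i) (Fin 3 → ℝ)) :
    (dofEquiv T z hz ω).1 i κ = facetMoment T z ω.1 i κ := rfl

theorem dofEquiv_snd {T : Affine.Simplex ℝ E3 3} {z : E3} {hz : z ∈ T.interior}
    (ω : SigmaH T z hz) : (dofEquiv T z hz ω).2 = matIntegral T ω.1 :=
  (matIntegral_eq hz (isPiece_piece ω.2)).symm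

theorem dofEquiv_eq_iff {T : Affine.Simplex ℝ E3 3} {z : E3} {hz : z ∈ T.interior}
    (ω : SigmaH T z hz)
    (d : ((i : Fin 4) → Module.Dual ℝ (P1 (facet T i) (Fin 3 → ℝ))) × SymMat) :
    dofEquiv T z hz ω = d ↔
      (∀ (i : Fin 4) (κ : P1 (facet T i) (Fin 3 → ℝ)), facetMoment T z ω.1 i κ = d.1 i κ) ∧
        matIntegral T ω.1 = d.2 := by
  rw [Prod.ext_iff, dofEquiv_snd, funext_iff]
  refine and_congr_left' (forall_congr' fun i => ?_)
  rw [LinearMap.ext_iff]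
  rfl

theorem eq_zero_of_weakDiv_eq_zero {T : Affine.Simplex ℝ E3 3} {z : E3} {hz : z ∈ T.interior}
    {ω : E3 →ₘ[volume.restrict (tet T)] SymMat} (hω : ω ∈ SigmaH T z hz)
    (hd : IsWeakDiv (tet T) ω 0) (hn : ∀ (i : Fin 4) (x : facet T i), normalTrace T z ω i x = 0) :
    ω = 0 := by
  have hp := isPiece_piece hω
  have hdiv (i : Fin 4) : affDiv (piece T z ω i) = 0 := by
    funext r
    have h := weakDiv_ae_eq hz hp (fun _ => MemLp.zero') hd r i
    -- The cell has positive measure, so an almost-everywhere identity between constants holds at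
    -- some point.
    have hne : Filter.NeBot (ae (volume.restrict (alfeldTet T z i))) := by
      rw [ae_restrict_neBot, ← measure_congr (openCell_ae_eq hz i)]
      exact ((isOpen_openCell T z i).measure_pos volume (openCell_nonempty hz i)).ne'
    obtain ⟨x, hx⟩ := h.exists
    exact hx.symm
  have h0 (i : Fin 4) : ∀ x ∈ facet T i, (piece T z ω i x).1 *ᵥ gradLam T i = 0 :=
    mulVec_gradLam_eq_zero (Subtype.ext (funext fun x => hn i x))
  have hzero := eq_zero_of_affDiv_eq_zero hz (jumpFree_piece hω) h0 hdiv
  have h : (⟨ω, hω⟩ : SigmaH T z hz) = 0 := by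
    refine (pieceMap_bijective T z hz).1 ?_
    rw [map_zero]
    exact Subtype.ext (funext hzero)
  exact congrArg Subtype.val h

end

theorem mainTheorem1 (T : Affine.Simplex ℝ E3 3) (z : E3) (hz : z ∈ T.interior) :
    Module.finrank ℝ (SigmaH T z hz) = 42 ∧
    -- the facet moments are 36 dofs, the integral over `T` is 6 dofs
    Module.finrank ℝ ((i : Fin 4) → P1 (facet T i) (Fin 3 → ℝ)) = 36 ∧
    Module.finrank ℝ SymMat = 6 ∧
    -- the dofs determine an element
    (∀ ω ∈ SigmaH T z hz, ∀ τ ∈ SigmaH T z hz,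
      (∀ i : Fin 4, ∀ κ ∈ P1 (facet T i) (Fin 3 → ℝ),
        facetMoment T z ω i κ = facetMoment T z τ i κ) →
      matIntegral T ω = matIntegral T τ → ω = τ) ∧
    -- and their values can be prescribed arbitrarily
    (∀ (ℓ : (i : Fin 4) → Module.Dual ℝ (P1 (facet T i) (Fin 3 → ℝ))) (A : SymMat),
      ∃! ω : E3 →ₘ[volume.restrict (tet T)] SymMat, ω ∈ SigmaH T z hz ∧
        (∀ (i : Fin 4) (κ : P1 (facet T i) (Fin 3 → ℝ)), facetMoment T z ω i κ = ℓ i κ) ∧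
        matIntegral T ω = A) ∧
    -- a divergence-free element with vanishing normal trace is zero
    (∀ ω ∈ SigmaH T z hz, IsWeakDiv (tet T) ω 0 →
      (∀ (i : Fin 4) (x : facet T i), normalTrace T z ω i x = 0) → ω = 0) := by
  refine ⟨?_, ?_, finrank_symMat, ?_, ?_, fun ω hω => eq_zero_of_weakDiv_eq_zero hω⟩
  · rw [(dofEquiv T z hz).finrank_eq, finrank_dof]
  · rw [Module.finrank_pi_fintype]
    simp [finrank_P1_facet]
  · intro ω hω τ hτ h1 h2
    have h : (⟨ω, hω⟩ : SigmaH T z hz) = ⟨τ, hτ⟩ := by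
      refine (dofEquiv T z hz).injective ((dofEquiv_eq_iff _ _).2 ⟨fun i κ => ?_, ?_⟩)
      · rw [dofEquiv_fst]
        exact h1 i κ κ.2
      · rw [dofEquiv_snd]
        exact h2
    exact congrArg Subtype.val h
  · intro ℓ A
    obtain ⟨ω, hω⟩ := (dofEquiv T z hz).surjective (ℓ, A)
    refine ⟨ω.1, ⟨ω.2, (dofEquiv_eq_iff ω (ℓ, A)).1 hω⟩, fun τ hτ => ?_⟩
    have h := (dofEquiv_eq_iff ⟨τ, hτ.1⟩ (ℓ, A)).2 hτ.2
    exact congrArg Subtype.val ((dofEquiv T z hz).injective (h.trans hω.symm))
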